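/- Let $(M,\nabla)$ be an affine manifold, i.e. a smooth manifold with an atlas whose transition maps are locally restrictions of affine maps of $\mathbb{R}^n$, with the flat torsion-free connection $\nabla$ for which the coordinate vector fields of affine charts are parallel. Let $h$ be a smooth symmetric bivector field on $M$, let $h_\#:T^*M\to TM$ be given by $\beta(h_\#(\alpha))=h(\alpha,\beta)$, and assume the contravariant Codazzi equation $(\nabla_{h_\#(\alpha)}h)(\beta,\gamma)=(\nabla_{h_\#(\beta)}h)(\alpha,\gamma)$ for all $\alpha,\beta,\gamma\in\Omega^1(M)$. Then $T^*M$ is a Lie algebroid with anchor $h_\#$ and bracket $[\alpha,\beta]_h=\nabla_{h_\#(\alpha)}\beta-\nabla_{h_\#(\beta)}\alpha$. Let $H^*(M,h)=\bigoplus_{k\ge 0} H^k(M,h)$ be its cohomology, i.e. the cohomology of the multivector fields on $M$ with the differential $$\mathbf{d}_hQ(\alpha_1,\dots,\alpha_p)=\sum_{j}(-1)^{j+1}h_\#(\alpha_j).Q(\alpha_1,\dots,\widehat{\alpha_j},\dots,\alpha_p)+\sum_{i<j}(-1)^{i+j}Q([\alpha_i,\alpha_j]_h,\alpha_1,\dots,\widehat{\alpha_i},\dots,\widehat{\alpha_j},\dots,\alpha_p).$$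 Let $p:TM\to M$ be the projection. For a vector field $X$ on $M$ let $X^v$ and $X^h$ be its vertical lift and its $\nabla$-horizontal lift to $TM$. For $\alpha\in\Omega^1(M)$ define $\alpha^v,\alpha^h\in\Omega^1(TM)$ by $\alpha^v(X^v)=\alpha(X)\circ p$, $\alpha^v(X^h)=0$, $\alpha^h(X^h)=\alpha(X)\circ p$, $\alpha^h(X^v)=0$. Let $\Pi$ be the Poisson bivector field on $TM$ with $\Pi(\alpha^v,\beta^v)=\Pi(\alpha^h,\beta^h)=0$ and $\Pi(\alpha^h,\beta^v)=-\Pi(\beta^v,\alpha^h)=h(\alpha,\beta)\circ p$. Let $H^*(TM,\Pi)=\bigoplus_{k\ge 0} H^k(TM,\Pi)$ be its Poisson cohomology, i.e. the cohomology of the multivector fields on $TM$ with the analogous differential $\mathbf{d}_\Pi$ of the Lie algebroid $T^*TM$ with anchor $\Pi_\#$ and the Koszul bracket $[\phi,\psi]_\Pi=\mathcal{L}_{\Pi_\#(\phi)}\psi-\mathcal{L}_{\Pi_\#(\psi)}\phi-d(\Pi(\phi,\psi))$. The vertical lift $Q^v$ of a $q$-vector field $Q$ on $M$ is the $q$-vector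 field on $TM$ with $i_{\alpha^h}Q^v=0$ and $Q^v(\alpha_1^v,\dots,\alpha_q^v)=Q(\alpha_1,\dots,\alpha_q)\circ p$ for all one-forms on $M$. Then the vertical lift of a $\mathbf{d}_h$-cocycle is a $\mathbf{d}_\Pi$-cocycle, there is a well-defined linear map $$V:H^*(M,h)\longrightarrow H^*(TM,\Pi),\qquad [Q]\longmapsto[Q^v],$$ and $V$ is injective. -/

import Mathlib

open Bundle Set Filter Topology
open scoped Manifold ContDiff DirectSum

noncomputable section

namespace AffinePoisson

/-! ### Affine manifolds -/

/-- The local diffeomorphisms of `E` that agree with an affine map near each point of their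
domain. -/
def affinePregroupoid (E : Type*) [NormedAddCommGroup E] [NormedSpace ℝ E] : Pregroupoid E where
  property f s := ∀ x ∈ s, ∃ A : E →ᴬ[ℝ] E, f =ᶠ[𝓝 x] A
  comp {f g u v} hf hg _ _ _ x hx := by
    obtain ⟨A, hA⟩ := hf x hx.1
    obtain ⟨B, hB⟩ := hg (f x) hx.2
    refine ⟨B.comp A, ?_⟩
    have hc : Tendsto f (𝓝 x) (𝓝 (f x)) := by
      rw [hA.eq_of_nhds]
      exact (A.continuous.tendsto x).congr' hA.symm
    filter_upwards [hc.eventually hB, hA] with y h1 h2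
    simp only [Function.comp_apply, ContinuousAffineMap.comp_apply]
    rw [h1, h2]
  id_mem x _ := ⟨ContinuousAffineMap.id ℝ E, EventuallyEq.refl _ _⟩
  locality {f u} _ h x hx := by
    obtain ⟨v, _, hxv, hf⟩ := h x hx
    exact hf x ⟨hx, hxv⟩
  congr {f g u} hu hfg hf x hx := by
    obtain ⟨A, hA⟩ := hf x hx
    refine ⟨A, ?_⟩
    filter_upwards [hA, hu.mem_nhds hx] with y h1 h2
    rw [hfg y h2, h1]

/-- The groupoid of local diffeomorphisms of `E` that are, together with their inverses, locally
restrictions of affine maps. An affine manifold modelled on `E` is a charted space `M` with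
`HasGroupoid M (affineGroupoid E)`, that is, with an atlas whose transition maps are affine. -/
def affineGroupoid (E : Type*) [NormedAddCommGroup E] [NormedSpace ℝ E] : StructureGroupoid E :=
  (affinePregroupoid E).groupoid

/-- An affine manifold is a smooth manifold. -/
instance isManifold_of_affine {E : Type*} [NormedAddCommGroup E] [NormedSpace ℝ E]
    {M : Type*} [TopologicalSpace M] [ChartedSpace E M] [HasGroupoid M (affineGroupoid E)] :
    IsManifold 𝓘(ℝ, E) ∞ M := by
  have key : ∀ (f : E → E) (s : Set E), (affinePregroupoid E).property f s → ContDiffOn ℝ ∞ f s := by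
    intro f s hf x hx
    obtain ⟨A, hA⟩ := hf x hx
    exact (A.contDiff.contDiffAt.congr_of_eventuallyEq hA).contDiffWithinAt
  have : HasGroupoid M (contDiffGroupoid ∞ 𝓘(ℝ, E)) := by
    refine hasGroupoid_of_le (G₁ := affineGroupoid E) inferInstance ?_
    intro e he
    refine ⟨?_, ?_⟩
    · simpa [contDiffPregroupoid] using key _ _ he.1
    · simpa [contDiffPregroupoid] using key _ _ he.2
  exact IsManifold.mk' _ _ _

/-! ### Linear algebra -/

/-- The contraction `b_♯ : V* → V` of a bilinear form `b` on `V*`, with `β (b_♯ α) = b (α, β)`. -/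
def sharp {V : Type*} [AddCommGroup V] [Module ℝ V] [TopologicalSpace V]
    [IsTopologicalAddGroup V] [ContinuousSMul ℝ V] [T2Space V] [FiniteDimensional ℝ V]
    (b : LinearMap.BilinForm ℝ (V →L[ℝ] ℝ)) : (V →L[ℝ] ℝ) →ₗ[ℝ] V where
  toFun α := (Module.evalEquiv ℝ V).symm
    ((b α).comp (LinearMap.toContinuousLinearMap (𝕜 := ℝ) (E := V) (F' := ℝ)).toLinearMap)
  map_add' α β := by simp [LinearMap.add_comp]
  map_smul' c α := by simp [LinearMap.smul_comp]

theorem apply_sharp {V : Type*} [AddCommGroup V] [Module ℝ V] [TopologicalSpace V]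
    [IsTopologicalAddGroup V] [ContinuousSMul ℝ V] [T2Space V] [FiniteDimensional ℝ V]
    (b : LinearMap.BilinForm ℝ (V →L[ℝ] ℝ)) (α β : V →L[ℝ] ℝ) : β (sharp b α) = b α β := by
  have := Module.apply_evalEquiv_symm_apply ℝ V (β : V →ₗ[ℝ] ℝ)
    ((b α).comp (LinearMap.toContinuousLinearMap (𝕜 := ℝ) (E := V) (F' := ℝ)).toLinearMap)
  refine this.trans ?_
  rw [LinearMap.comp_apply]
  congr 1

/-! ### One-forms and multivector fields on a manifold -/

section Manifold

variable {F : Type*} [NormedAddCommGroup F] [NormedSpace ℝ F]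
  {H : Type*} [TopologicalSpace H] (I : ModelWithCorners ℝ F H)
  {N : Type*} [TopologicalSpace N] [ChartedSpace H N]

/-- The cotangent space at `x`. -/
abbrev Cotangent (x : N) : Type _ := TangentSpace I x →L[ℝ] ℝ

instance tangentSpace_t2Space (x : N) : T2Space (TangentSpace I x) :=
  inferInstanceAs (T2Space F)

instance tangentSpace_finiteDimensional [FiniteDimensional ℝ F] (x : N) :
    FiniteDimensional ℝ (TangentSpace I x) :=
  inferInstanceAs (FiniteDimensional ℝ F)

variable (N) in
/-- Not necessarily smooth `k`-vector fields: families of alternating `k`-forms `Q x` on the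
cotangent spaces, that is, of elements of `⋀ᵏ T_x N`. -/
def RawMultivectorField (k : ℕ) : Type _ := ∀ x : N, Cotangent I x [⋀^Fin k]→ₗ[ℝ] ℝ

instance (k : ℕ) : AddCommGroup (RawMultivectorField I N k) :=
  inferInstanceAs (AddCommGroup (∀ x : N, Cotangent I x [⋀^Fin k]→ₗ[ℝ] ℝ))

instance (k : ℕ) : Module ℝ (RawMultivectorField I N k) :=
  inferInstanceAs (Module ℝ (∀ x : N, Cotangent I x [⋀^Fin k]→ₗ[ℝ] ℝ))

variable {I} in
theorem RawMultivectorField.add_apply {k : ℕ} (Q R : RawMultivectorField I N k) (x : N)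
    (ξ : Fin k → Cotangent I x) : (Q + R) x ξ = Q x ξ + R x ξ := rfl

variable {I} in
theorem RawMultivectorField.smul_apply {k : ℕ} (c : ℝ) (Q : RawMultivectorField I N k) (x : N)
    (ξ : Fin k → Cotangent I x) : (c • Q) x ξ = c * Q x ξ := rfl

variable [IsManifold I ∞ N]

variable (N) in
/-- Smooth one-forms on `N`. -/
abbrev OneForm : Type _ :=
  ContMDiffSection I (F →L[ℝ] ℝ) ∞ (fun x : N => TangentSpace I x →L[ℝ] Bundle.Trivial N ℝ x)

/-- For `ξ : F*` and a chart at `x₀`, the covector at `y` with constant components `ξ` in that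
chart. -/
def chartCovector (x₀ : N) (ξ : F →L[ℝ] ℝ) (y : N) : Cotangent I y :=
  ξ.comp ((trivializationAt F (TangentSpace I) x₀).continuousLinearMapAt ℝ y)

/-- For `ξ` in the cotangent space at `x`, the covector at `y` with the same components as `ξ` in
the preferred chart at `x`. -/
def coordExtend (x : N) (ξ : Cotangent I x) (y : N) : Cotangent I y :=
  chartCovector I x (ξ.comp ((trivializationAt F (TangentSpace I) x).symmL ℝ x)) y

variable (N) in
/-- Smooth `k`-vector fields: the `k`-vector fields whose components in charts are smooth. -/
def multivectorField (k : ℕ) : Submodule ℝ (RawMultivectorField I N k) where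
  carrier := {Q | ∀ (x₀ : N) (ξ : Fin k → F →L[ℝ] ℝ),
    ContMDiffOn I 𝓘(ℝ, ℝ) ∞ (fun y => Q y fun i => chartCovector I x₀ (ξ i) y)
      (chartAt H x₀).source}
  add_mem' hQ hR x₀ ξ := (hQ x₀ ξ).add (hR x₀ ξ)
  zero_mem' _ _ := contMDiffOn_const
  smul_mem' _ _ hQ x₀ ξ := contMDiffOn_const.mul (hQ x₀ ξ)

/-- The function `Q (α₁, …, α_k)` is smooth. -/
theorem contMDiff_eval [FiniteDimensional ℝ F] {k : ℕ} (Q : multivectorField I N k)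
    (α : Fin k → OneForm I N) :
    ContMDiff I 𝓘(ℝ, ℝ) ∞ (fun y => Q.1 y fun i => α i y) := by
  intro x₀
  set e := trivializationAt F (TangentSpace I : N → Type _) x₀ with he
  have hbase : e.baseSet = (chartAt H x₀).source := rfl
  have hx₀ : x₀ ∈ e.baseSet := mem_baseSet_trivializationAt F (TangentSpace I : N → Type _) x₀
  let b := Module.finBasis ℝ F
  -- the components of the forms in the chart
  have hcomp : ∀ i r, ContMDiffAt I 𝓘(ℝ, ℝ) ∞
      (fun y => (α i y) (e.symmL ℝ y (b r))) x₀ := by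
    intro i r
    have h1 := ((α i).contMDiff x₀)
    rw [contMDiffAt_hom_bundle] at h1
    have h2 : ContMDiffAt I 𝓘(ℝ, ℝ) ∞ (fun y => (ContinuousLinearMap.inCoordinates F
        (TangentSpace I) ℝ (Bundle.Trivial N ℝ) x₀ y x₀ y (α i y)) (b r)) x₀ :=
      h1.2.clm_apply contMDiffAt_const
    simpa [ContinuousLinearMap.inCoordinates, ← he] using h2
  have hcov : ∀ y ∈ e.baseSet, ∀ i, (α i y : Cotangent I y) =
      ∑ r, (α i y) (e.symmL ℝ y (b r)) •
        chartCovector I x₀ (LinearMap.toContinuousLinearMap (b.coord r)) y := by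
    intro y hy i
    ext v
    have hv : v = ∑ r, (b.repr (e.continuousLinearMapAt ℝ y v)) r • e.symmL ℝ y (b r) := by
      conv_lhs => rw [← e.symmL_continuousLinearMapAt (R := ℝ) hy v,
        ← b.sum_repr (e.continuousLinearMapAt ℝ y v)]
      rw [map_sum]
      exact Finset.sum_congr rfl fun r _ => map_smul _ _ _
    conv_lhs => rw [hv]
    simp [chartCovector, ← he, mul_comm]
  have hsum : (fun y => Q.1 y fun i => α i y) =ᶠ[𝓝 x₀] fun y =>
      ∑ s : Fin k → Fin (Module.finrank ℝ F), (∏ i, (α i y) (e.symmL ℝ y (b (s i)))) *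
        Q.1 y fun i => chartCovector I x₀ (LinearMap.toContinuousLinearMap (b.coord (s i))) y := by
    filter_upwards [e.open_baseSet.mem_nhds hx₀] with y hy
    have : (fun i => (α i y : Cotangent I y)) = _ := funext (hcov y hy)
    rw [this]
    change (Q.1 y).toMultilinearMap _ = _
    rw [MultilinearMap.map_sum]
    refine Finset.sum_congr rfl fun s _ => ?_
    rw [MultilinearMap.map_smul_univ]
    rfl
  refine ContMDiffAt.congr_of_eventuallyEq ?_ hsum
  refine ContMDiffAt.sum fun s _ => ?_
  refine ContMDiffAt.mul (contMDiffAt_finsetProd fun i _ => hcomp i (s i)) ?_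
  exact ((Q.2 x₀ _).contMDiffAt ((chartAt H x₀).open_source.mem_nhds (mem_chart_source H x₀)))

/-- A multivector field seen as a multilinear function on one-forms. -/
def evalForms (k : ℕ) :
    multivectorField I N k →ₗ[ℝ] ((Fin k → OneForm I N) → N → ℝ) where
  toFun Q α x := Q.1 x fun i => α i x
  map_add' _ _ := rfl
  map_smul' _ _ := rfl

/-! ### Cohomology of a Lie algebroid structure on the cotangent bundle -/

/-- The differential of the Lie algebroid structure on `T*N` with anchor `ρ` and bracket `br`:
`(dQ)(α₀, …, α_k) = ∑ⱼ (-1)ʲ ρ(αⱼ) · Q(α₀, …, α̂ⱼ, …, α_k)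
  + ∑_{i<j} (-1)^(i+j) Q([αᵢ, αⱼ], α₀, …, α̂ᵢ, …, α̂ⱼ, …, α_k)`.
In the second sum the bracket is moved from the first place to the place of `αᵢ`, which
multiplies the term by `(-1)ⁱ`. -/
def algebroidDifferential [FiniteDimensional ℝ F]
    (ρ : ∀ x : N, Cotangent I x →ₗ[ℝ] TangentSpace I x)
    (br : OneForm I N → OneForm I N → ∀ x : N, Cotangent I x) (k : ℕ) :
    multivectorField I N k →ₗ[ℝ] ((Fin (k + 1) → OneForm I N) → N → ℝ) where
  toFun Q α x :=
    ∑ j : Fin (k + 1), (-1) ^ (j : ℕ) *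
        mvfderiv I (fun y => Q.1 y fun l => α (j.succAbove l) y) x (ρ x (α j x)) +
      ∑ j : Fin (k + 1), ∑ i : Fin k with i.castSucc < j, (-1) ^ (j : ℕ) *
        Q.1 x (Function.update (fun l => (α (j.succAbove l) x : Cotangent I x)) i
          (br (α i.castSucc) (α j) x))
  map_add' Q R := by
    funext α x
    have h : ∀ (S : multivectorField I N k) (j : Fin (k + 1)),
        MDifferentiableAt I 𝓘(ℝ, ℝ) (fun y => S.1 y fun l => α (j.succAbove l) y) x :=
      fun S j => (contMDiff_eval I S fun l => α (j.succAbove l)).mdifferentiable (by simp) x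
    have h2 : ∀ j : Fin (k + 1),
        mvfderiv I (fun y => (Q + R).1 y fun l => α (j.succAbove l) y) x =
        mvfderiv I (fun y => Q.1 y fun l => α (j.succAbove l) y) x +
        mvfderiv I (fun y => R.1 y fun l => α (j.succAbove l) y) x :=
      fun j => mvfderiv_add (h Q j) (h R j)
    simp only [Pi.add_apply, h2]
    simp only [add_apply, Submodule.coe_add, RawMultivectorField.add_apply, mul_add,
      Finset.sum_add_distrib]
    ring
  map_smul' c Q := by
    funext α x
    have h : ∀ j : Fin (k + 1),
        MDifferentiableAt I 𝓘(ℝ, ℝ) (fun y => Q.1 y fun l => α (j.succAbove l) y) x :=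
      fun j => (contMDiff_eval I Q fun l => α (j.succAbove l)).mdifferentiable (by simp) x
    have h2 : ∀ j : Fin (k + 1),
        mvfderiv I (fun y => (c • Q).1 y fun l => α (j.succAbove l) y) x =
        c • mvfderiv I (fun y => Q.1 y fun l => α (j.succAbove l) y) x := by
      intro j
      have := mvfderiv_smul (I := I) (a := fun _ : N => c) mdifferentiableAt_const (h j)
      rw [mvfderiv_const] at this
      ext v
      have h3 := congrArg (fun L => L v) this
      simp only [ContinuousLinearMap.zero_smulRight, add_zero] at h3
      exact h3
    simp only [Pi.smul_apply, h2]
    simp only [smul_apply, Submodule.coe_smul, RawMultivectorField.smul_apply,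
      smul_eq_mul, RingHom.id_apply, mul_add, Finset.mul_sum]
    congr 1
    · exact Finset.sum_congr rfl fun j _ => by ring
    · exact Finset.sum_congr rfl fun j _ => Finset.sum_congr rfl fun i _ => by ring

/-- The `k`-cocycles: the kernel of the differential. -/
def cocycles [FiniteDimensional ℝ F]
    (ρ : ∀ x : N, Cotangent I x →ₗ[ℝ] TangentSpace I x)
    (br : OneForm I N → OneForm I N → ∀ x : N, Cotangent I x) (k : ℕ) :
    Submodule ℝ (multivectorField I N k) :=
  LinearMap.ker (algebroidDifferential I ρ br k)

/-- The `k`-coboundaries: `0` in degree `0`, and the `Q` of the form `dT` in positive degree. -/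
def coboundaries [FiniteDimensional ℝ F]
    (ρ : ∀ x : N, Cotangent I x →ₗ[ℝ] TangentSpace I x)
    (br : OneForm I N → OneForm I N → ∀ x : N, Cotangent I x) :
    ∀ k : ℕ, Submodule ℝ (multivectorField I N k)
  | 0 => ⊥
  | k + 1 => (LinearMap.range (algebroidDifferential I ρ br k)).comap (evalForms I (k + 1))

/-- The cohomology in degree `k`: cocycles modulo coboundaries. For a Lie algebroid every coboundary
is a cocycle; `submoduleOf` regards the coboundaries as a subspace of the space of cocycles. -/
abbrev Cohomology [FiniteDimensional ℝ F]
    (ρ : ∀ x : N, Cotangent I x →ₗ[ℝ] TangentSpace I x)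
    (br : OneForm I N → OneForm I N → ∀ x : N, Cotangent I x) (k : ℕ) : Type _ :=
  cocycles I ρ br k ⧸ (coboundaries I ρ br k).submoduleOf (cocycles I ρ br k)

/-! ### Poisson cohomology -/

/-- The derivative at `x` of the components of the one-form `α` in the preferred chart at `x`:
`coordDeriv α x v w = ∑ vⁱ wʲ ∂ᵢ αⱼ`. -/
def coordDeriv (α : OneForm I N) (x : N) : TangentSpace I x →L[ℝ] Cotangent I x :=
  (ContinuousLinearMap.precomp ℝ
      ((trivializationAt F (TangentSpace I) x).continuousLinearMapAt ℝ x)).comp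
    (mvfderiv I (fun y => (show Cotangent I y from α y).comp
      ((trivializationAt F (TangentSpace I) x).symmL ℝ y)) x)

/-- The exterior derivative of a one-form: in coordinates,
`dα(v, w) = ∑ (∂ᵢ αⱼ - ∂ⱼ αᵢ) vⁱ wʲ`. -/
def dForm (α : OneForm I N) (x : N) : TangentSpace I x →L[ℝ] Cotangent I x :=
  let D : F →L[ℝ] F →L[ℝ] ℝ := coordDeriv I α x
  D - D.flip

/-- The Lie derivative of a one-form, `L_X α = d(α(X)) + i_X dα`. -/
def lieDerivForm (X : ∀ x : N, TangentSpace I x) (α : OneForm I N) (x : N) : Cotangent I x :=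
  mvfderiv I (fun y => (α y (X y) : ℝ)) x + dForm I α x (X x)

/-- The Koszul bracket of one-forms of a bivector field `Π`,
`[φ, ψ]_Π = L_{Π_♯ φ} ψ - L_{Π_♯ ψ} φ - d(Π(φ, ψ))`. -/
def koszulBracket [FiniteDimensional ℝ F] (P : ∀ x : N, LinearMap.BilinForm ℝ (Cotangent I x))
    (φ ψ : OneForm I N) (x : N) : Cotangent I x :=
  lieDerivForm I (fun y => sharp (P y) (φ y)) ψ x - lieDerivForm I (fun y => sharp (P y) (ψ y)) φ x
    - mvfderiv I (fun y => P y (φ y) (ψ y)) x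

/-- The cocycles of the Poisson cohomology of a bivector field `Π`. -/
abbrev poissonCocycles [FiniteDimensional ℝ F]
    (P : ∀ x : N, LinearMap.BilinForm ℝ (Cotangent I x)) (k : ℕ) :
    Submodule ℝ (multivectorField I N k) :=
  cocycles I (fun x => sharp (P x)) (koszulBracket I P) k

/-- The Poisson cohomology of a bivector field `Π`: the cohomology of the Lie algebroid
`(T*N, Π_♯, [ , ]_Π)`. -/
abbrev PoissonCohomology [FiniteDimensional ℝ F]
    (P : ∀ x : N, LinearMap.BilinForm ℝ (Cotangent I x)) (k : ℕ) : Type _ :=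
  Cohomology I (fun x => sharp (P x)) (koszulBracket I P) k

end Manifold

/-! ### Contravariant pseudo-Hessian manifolds -/

section Affine

variable {E : Type*} [NormedAddCommGroup E] [NormedSpace ℝ E] [FiniteDimensional ℝ E]
  {M : Type*} [TopologicalSpace M] [ChartedSpace E M] [HasGroupoid M (affineGroupoid E)]

/-- The covariant derivative `∇_w α` of a one-form at `x` for the flat connection `∇` of an affine
manifold. The preferred chart at `x` is affine, its coordinate fields are parallel, and `∇` is the
derivative of components in it. -/
def nablaForm (α : OneForm 𝓘(ℝ, E) M) (x : M) (w : TangentSpace 𝓘(ℝ, E) x) :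
    Cotangent 𝓘(ℝ, E) x :=
  coordDeriv 𝓘(ℝ, E) α x w

/-- The covariant derivative `(∇_w h)(ξ, η)` at `x` of a field `h` of bilinear forms on the
cotangent spaces, for the flat connection `∇`: the derivative of `h` on the parallel extensions of
`ξ` and `η`. -/
def nablaBilin (h : ∀ x : M, LinearMap.BilinForm ℝ (Cotangent 𝓘(ℝ, E) x)) (x : M)
    (w : TangentSpace 𝓘(ℝ, E) x) (ξ η : Cotangent 𝓘(ℝ, E) x) : ℝ :=
  mvfderiv 𝓘(ℝ, E)
    (fun y => h y (coordExtend 𝓘(ℝ, E) x ξ y) (coordExtend 𝓘(ℝ, E) x η y)) x w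

/-- `h` is a pseudo-Hessian bivector field on the affine manifold `M`: a smooth symmetric bivector
field satisfying the contravariant Codazzi equation. -/
structure IsPseudoHessian (h : ∀ x : M, LinearMap.BilinForm ℝ (Cotangent 𝓘(ℝ, E) x)) : Prop where
  symm : ∀ x, (h x).IsSymm
  smooth : ∀ (x₀ : M) (ξ η : E →L[ℝ] ℝ), ContMDiffOn 𝓘(ℝ, E) 𝓘(ℝ, ℝ) ∞
    (fun y => h y (chartCovector 𝓘(ℝ, E) x₀ ξ y) (chartCovector 𝓘(ℝ, E) x₀ η y))
    (chartAt E x₀).source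
  codazzi : ∀ (x : M) (α β γ : Cotangent 𝓘(ℝ, E) x),
    nablaBilin h x (sharp (h x) α) β γ = nablaBilin h x (sharp (h x) β) α γ

/-- The bracket `[α, β]_h = ∇_{h_♯ α} β - ∇_{h_♯ β} α` on one-forms. -/
def hessianBracket (h : ∀ x : M, LinearMap.BilinForm ℝ (Cotangent 𝓘(ℝ, E) x))
    (α β : OneForm 𝓘(ℝ, E) M) (x : M) : Cotangent 𝓘(ℝ, E) x :=
  nablaForm β x (sharp (h x) (α x)) - nablaForm α x (sharp (h x) (β x))

/-- The cocycles of the Lie algebroid `(T*M, h_♯, [ , ]_h)`. -/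
abbrev hessianCocycles (h : ∀ x : M, LinearMap.BilinForm ℝ (Cotangent 𝓘(ℝ, E) x)) (k : ℕ) :
    Submodule ℝ (multivectorField 𝓘(ℝ, E) M k) :=
  cocycles 𝓘(ℝ, E) (fun x => sharp (h x)) (hessianBracket h) k

/-- `Hᵏ(M, h)`, the cohomology of the Lie algebroid `(T*M, h_♯, [ , ]_h)`. -/
abbrev HessianCohomology (h : ∀ x : M, LinearMap.BilinForm ℝ (Cotangent 𝓘(ℝ, E) x)) (k : ℕ) :
    Type _ :=
  Cohomology 𝓘(ℝ, E) (fun x => sharp (h x)) (hessianBracket h) k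

/-! ### The tangent bundle -/

/-- The vertical lift `T_x M → T_{(x,u)} TM`, the differential at `u` of the inclusion of the
fibre `T_x M` into `TM`. -/
def verticalLift (z : TangentBundle 𝓘(ℝ, E) M) :
    TangentSpace 𝓘(ℝ, E) z.1 →L[ℝ] TangentSpace 𝓘(ℝ, E).tangent z :=
  mfderiv 𝓘(ℝ, E) 𝓘(ℝ, E).tangent
    (fun w : E => (⟨z.1, w⟩ : TangentBundle 𝓘(ℝ, E) M)) z.2

/-- The horizontal lift `T_x M → T_{(x,u)} TM` of the flat connection, the differential at `x` of
the parallel local vector field with value `u` at `x`. -/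
def horizontalLift (z : TangentBundle 𝓘(ℝ, E) M) :
    TangentSpace 𝓘(ℝ, E) z.1 →L[ℝ] TangentSpace 𝓘(ℝ, E).tangent z :=
  mfderiv 𝓘(ℝ, E) 𝓘(ℝ, E).tangent
    (fun y => (⟨y, (trivializationAt E (TangentSpace 𝓘(ℝ, E)) z.1).symmL ℝ y
      ((trivializationAt E (TangentSpace 𝓘(ℝ, E)) z.1).continuousLinearMapAt ℝ z.1 z.2)⟩ :
        TangentBundle 𝓘(ℝ, E) M)) z.1

/-- The bivector field `Π` on `TM` associated to `h`. A covector `φ` at `(x, u)` has the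
horizontal part `φ ∘ hor` and the vertical part `φ ∘ ver`, both covectors at `x`, so that this is
the skew-symmetric form with `Π(αʰ, βʰ) = Π(αᵛ, βᵛ) = 0` and `Π(αʰ, βᵛ) = h(α, β)`. -/
def tangentBivector (h : ∀ x : M, LinearMap.BilinForm ℝ (Cotangent 𝓘(ℝ, E) x))
    (z : TangentBundle 𝓘(ℝ, E) M) :
    LinearMap.BilinForm ℝ (Cotangent 𝓘(ℝ, E).tangent z) :=
  LinearMap.mk₂ ℝ
    (fun φ ψ => h z.1 (φ.comp (horizontalLift z)) (ψ.comp (verticalLift z)) -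
      h z.1 (ψ.comp (horizontalLift z)) (φ.comp (verticalLift z)))
    (fun φ φ' ψ => by simp only [ContinuousLinearMap.add_comp, map_add, LinearMap.add_apply]; ring)
    (fun c φ ψ => by
      simp only [ContinuousLinearMap.smul_comp, map_smul, LinearMap.smul_apply, smul_eq_mul]; ring)
    (fun φ ψ ψ' => by simp only [ContinuousLinearMap.add_comp, map_add, LinearMap.add_apply]; ring)
    (fun c φ ψ => by
      simp only [ContinuousLinearMap.smul_comp, map_smul, LinearMap.smul_apply, smul_eq_mul]; ring)

/-- The vertical lift `Qᵛ` of a multivector field: `Qᵛ(φ₁, …, φ_k) = Q(φ₁ ∘ ver, …, φ_k ∘ ver)`,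
so that `i_{αʰ} Qᵛ = 0` and `Qᵛ(α₁ᵛ, …, α_kᵛ) = Q(α₁, …, α_k) ∘ p`. -/
def verticalLiftMultivector {k : ℕ}
    (Q : RawMultivectorField 𝓘(ℝ, E) M k) :
    RawMultivectorField 𝓘(ℝ, E).tangent (TangentBundle 𝓘(ℝ, E) M) k :=
  fun z => (Q z.1).compLinearMap (ContinuousLinearMap.precomp ℝ (verticalLift z)).toLinearMap

end Affine

end AffinePoisson
end

open AffinePoisson

/-! At each point, a differential is computed in the preferred chart, with covectors extended with
constant components. By the product rule and a combinatorial cancellation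
(`alternatingMap_sum_update_cancel`), `algebroidDifferential_apply` writes it as
`localDifferential`, which differentiates only the components of `Q`, plus terms in
`bracketTorsion`, the part of the bracket free of derivatives of the forms. The torsion of `[ , ]_h`
vanishes because `∇` is the derivative of components. The torsion of the Koszul bracket is the
derivative of the components of `Π`, as in `[dxⁱ, dxʲ] = dΠⁱʲ`.

On `TM` the affine structure makes horizontal and vertical lifts constant in the charts, so the
components of `Π` and of `Tᵛ` are pulled back from `M`. Hence the torsion has no vertical part and
is invisible to `Tᵛ`. Since `Π_♯ φ` projects to `-h_♯` of the vertical part of `φ`, this gives `d_Π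
Tᵛ = -(d_h T)ᵛ` (`algebroidDifferential_verticalLift_apply`), so `V` is well defined.

For injectivity, a multivector field `P` on `TM` is restricted to the zero section and to covectors
`ξᵛ` (`restrictVertical`). There `Π_♯ ξᵛ` is minus the horizontal lift of `h_♯ ξ`, which is tangent
to the zero section, and the torsion of two vertical covectors is zero because `Π` vanishes on them.
So the restriction also intertwines the differentials up to sign
(`algebroidDifferential_comp_connectionMap`). As it is a left inverse of the vertical lift, `Qᵛ =
d_Π P` forces `Q = d_h (-restrictVertical P)`. -/

noncomputable section

namespace AffinePoisson

/-! ### Product rule and alternating-sum cancellation. -/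

section General

variable {F : Type*} [NormedAddCommGroup F] [NormedSpace ℝ F]
  {H : Type*} [TopologicalSpace H] {I : ModelWithCorners ℝ F H}
  {N : Type*} [TopologicalSpace N] [ChartedSpace H N]

theorem mvfderiv_congr {G : Type*} [NormedAddCommGroup G] [NormedSpace ℝ G] {f g : N → G} {x : N}
    (hfg : f =ᶠ[𝓝 x] g) (v : TangentSpace I x) : mvfderiv I f x v = mvfderiv I g x v := by
  simp only [mvfderiv, hfg.mfderiv_eq (I := I) (I' := 𝓘(ℝ, G)), ContinuousLinearMap.comp_apply]
  rfl

/-- Product rule for the evaluation of a variable multilinear map at variable vectors. -/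
theorem mvfderiv_multilinear_apply {V : Type*} [NormedAddCommGroup V] [NormedSpace ℝ V] {k : ℕ}
    {C : N → ContinuousMultilinearMap ℝ (fun _ : Fin k => V) ℝ} {a : Fin k → N → V} {x : N}
    (hC : MDifferentiableAt I 𝓘(ℝ, ContinuousMultilinearMap ℝ (fun _ : Fin k => V) ℝ) C x)
    (ha : ∀ i, MDifferentiableAt I 𝓘(ℝ, V) (a i) x) (v : TangentSpace I x) :
    mvfderiv I (fun y => C y fun i => a i y) x v =
      mvfderiv I (fun y => C y fun i => a i x) x v +
        ∑ i, C x (Function.update (fun l => a l x) i (mvfderiv I (a i) x v)) := by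
  have key : ∀ (b : Fin k → N → V) (_ : ∀ i, MDifferentiableAt I 𝓘(ℝ, V) (b i) x),
      mvfderiv I (fun y => C y fun i => b i y) x v =
        (mvfderiv I C x v) (fun i => b i x) +
        ∑ i, C x (Function.update (fun l => b l x) i (mvfderiv I (b i) x v)) := by
    intro b hb
    have h1 : HasFDerivWithinAt (writtenInExtChartAt I
        𝓘(ℝ, ContinuousMultilinearMap ℝ (fun _ : Fin k => V) ℝ) x C) (mvfderiv I C x) (range I)
        (extChartAt I x x) := hC.hasMFDerivAt.2
    have h2 : ∀ i, HasFDerivWithinAt (writtenInExtChartAt I 𝓘(ℝ, V) x (b i))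
        (mvfderiv I (b i) x) (range I) (extChartAt I x x) := fun i => (hb i).hasMFDerivAt.2
    set L : F →L[ℝ] ℝ := (ContinuousMultilinearMap.apply ℝ (fun _ : Fin k => V) ℝ fun i => b i x).comp
        (mvfderiv I C x : F →L[ℝ] _) +
      ∑ i, ((C x).toContinuousLinearMap (fun l => b l x) i).comp (mvfderiv I (b i) x : F →L[ℝ] V)
      with hL
    have h3 : HasFDerivWithinAt (writtenInExtChartAt I 𝓘(ℝ, ℝ) x fun y => C y fun i => b i y) L
        (range I) (extChartAt I x x) := by
      convert! h1.continuousMultilinearMap_apply h2 using 1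
      simp [writtenInExtChartAt, hL]
      rfl
    have h4 : ContinuousAt (fun y => C y fun i => b i y) x :=
      (ContinuousMultilinearMap.hasStrictFDerivAt_uncurry (C x, fun i => b i x)).continuousAt.comp
        (f := fun y => (C y, fun i => b i y))
        (hC.continuousAt.prodMk (continuousAt_pi.2 fun i => (hb i).continuousAt))
    have h5 : HasMFDerivAt I 𝓘(ℝ, ℝ) (fun y => C y fun i => b i y) x L := ⟨h4, h3⟩
    refine (DFunLike.congr_fun h5.mfderiv v).trans ?_
    have happ : ∀ (C' : F →L[ℝ] ContinuousMultilinearMap ℝ (fun _ : Fin k => V) ℝ)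
        (b' : Fin k → F →L[ℝ] V) (w : F),
        ((ContinuousMultilinearMap.apply ℝ (fun _ : Fin k => V) ℝ fun i => b i x).comp C' +
          ∑ i, ((C x).toContinuousLinearMap (fun l => b l x) i).comp (b' i)) w =
        C' w (fun i => b i x) + ∑ i, C x (Function.update (fun l => b l x) i (b' i w)) := by
      intro C' b' w
      simp
    exact happ (mvfderiv I C x) (fun i => mvfderiv I (b i) x) v
  -- The same formula for the constant family `a i x` identifies the term in the derivative of `C`.
  rw [key a ha, key (fun i _ => a i x) fun i => mdifferentiableAt_const]
  have h0 : ∀ i, C x (Function.update (fun l => a l x) i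
      (mvfderiv I (fun _ : N => a i x) x v)) = 0 := fun i => by
    rw [mvfderiv_const]
    exact (C x).map_coord_zero i (by simp)
  simp only [h0, Finset.sum_const_zero, add_zero]

theorem removeNth_update_succAbove {V : Type*} {k : ℕ} (ξ : Fin (k + 1) → V) (j : Fin (k + 1))
    (l : Fin k) (b : V) :
    j.removeNth (Function.update ξ (j.succAbove l) b) =
      Function.update (fun l => ξ (j.succAbove l)) l b := by
  funext m
  by_cases hm : m = l
  · subst hm; simp [Fin.removeNth]
  · simp [Fin.removeNth, hm]

theorem sum_filter_castSucc_lt {k : ℕ} (j : Fin (k + 1)) (f : Fin (k + 1) → ℝ) :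
    ∑ i : Fin k with i.castSucc < j, f i.castSucc = ∑ m, if m < j then f m else 0 := by
  rw [Fin.sum_univ_succAbove _ j, Finset.sum_filter]
  simp only [lt_self_iff_false, if_false, zero_add, Fin.succAbove_lt_iff_castSucc_lt]
  refine Finset.sum_congr rfl fun i _ => ?_
  split_ifs with h
  · rw [Fin.succAbove_of_castSucc_lt _ _ h]
  · rfl

/-- Here `B i j` stands for the derivative of the `j`-th form along the anchor of the `i`-th. In the
bracket terms, `-B j i` cancels directly the term of the first sum in the same slot. What remains
pairs the term omitting `j` with the term omitting `m`, both containing `B j m`, and these are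
opposite by alternation. -/
theorem alternatingMap_sum_update_cancel {V : Type*} [AddCommGroup V] [Module ℝ V] {k : ℕ}
    (q : V [⋀^Fin k]→ₗ[ℝ] ℝ) (ξ : Fin (k + 1) → V) (B : Fin (k + 1) → Fin (k + 1) → V) :
    ∑ j : Fin (k + 1), (-1) ^ (j : ℕ) *
        ∑ l : Fin k, q (Function.update (fun l => ξ (j.succAbove l)) l (B j (j.succAbove l))) +
      ∑ j : Fin (k + 1), ∑ i : Fin k with i.castSucc < j, (-1) ^ (j : ℕ) *
        q (Function.update (fun l => ξ (j.succAbove l)) i (B i.castSucc j - B j i.castSucc)) = 0 := by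
  set g : Fin (k + 1) → V → Fin (k + 1) → ℝ :=
    fun j b m => (-1) ^ (j : ℕ) * q (j.removeNth (Function.update ξ m b)) with hg
  have h1 : ∀ j : Fin (k + 1), (-1) ^ (j : ℕ) *
        ∑ l : Fin k, q (Function.update (fun l => ξ (j.succAbove l)) l (B j (j.succAbove l))) =
      ∑ m, if m = j then 0 else g j (B j m) m := by
    intro j
    rw [Fin.sum_univ_succAbove _ j, Finset.mul_sum]
    simp only [hg, removeNth_update_succAbove, Fin.succAbove_ne, if_true, if_false, zero_add]
  have h2 : ∀ j : Fin (k + 1), ∑ i : Fin k with i.castSucc < j, (-1) ^ (j : ℕ) *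
        q (Function.update (fun l => ξ (j.succAbove l)) i (B i.castSucc j - B j i.castSucc)) =
      ∑ m, if m < j then g j (B m j) m - g j (B j m) m else 0 := by
    intro j
    rw [← sum_filter_castSucc_lt j fun m => g j (B m j) m - g j (B j m) m]
    refine Finset.sum_congr rfl fun i hi => ?_
    have h := (Finset.mem_filter.1 hi).2
    have h3 : i.castSucc = j.succAbove i := (Fin.succAbove_of_castSucc_lt _ _ h).symm
    rw [hg]
    dsimp only
    rw [AlternatingMap.map_update_sub, h3, removeNth_update_succAbove, removeNth_update_succAbove]
    ring
  have h3 : ∀ j m : Fin (k + 1), j < m → g j (B j m) m + g m (B j m) j = 0 := by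
    intro j m hjm
    -- In a tuple with `B j m` at both places `j` and `m`, deleting one copy or the other gives the
    -- same value of `q` up to the sign `-(-1)^(j+m)`.
    have := q.neg_one_pow_smul_map_removeNth_add_eq_zero_of_eq
      (v := Function.update (Function.update ξ j (B j m)) m (B j m)) (i := j) (j := m)
      (by simp [hjm.ne]) hjm.ne
    have e1 : j.removeNth (Function.update (Function.update ξ j (B j m)) m (B j m)) =
        j.removeNth (Function.update ξ m (B j m)) := by
      rw [Function.update_comm hjm.ne, Fin.removeNth_update]
    rw [e1, Fin.removeNth_update] at this
    simpa [hg] using this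
  simp only [h1, h2]
  have h4 : ∑ j, ∑ m, (if m < j then g j (B m j) m else 0) =
      ∑ j, ∑ m, (if j < m then g m (B j m) j else 0) := Finset.sum_comm
  have h5 : ∑ j, ∑ m, ((if j < m then g j (B j m) m else 0) +
      (if j < m then g m (B j m) j else 0)) = 0 := by
    refine Finset.sum_eq_zero fun j _ => Finset.sum_eq_zero fun m _ => ?_
    split_ifs with h
    · exact h3 j m h
    · simp
  refine Eq.trans ?_ h5
  simp only [Finset.sum_add_distrib]
  rw [← h4]
  simp only [← Finset.sum_add_distrib]
  refine Finset.sum_congr rfl fun j _ => Finset.sum_congr rfl fun m _ => ?_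
  rcases lt_trichotomy m j with h | h | h
  · simp [h, h.ne, h.not_gt]
  · simp [h]
  · simp [h, h.ne', h.not_gt]

end General

/-! ### The differential in the preferred chart. -/

section General

variable {F : Type*} [NormedAddCommGroup F] [NormedSpace ℝ F]
  {H : Type*} [TopologicalSpace H] {I : ModelWithCorners ℝ F H}
  {N : Type*} [TopologicalSpace N] [ChartedSpace H N] [IsManifold I ∞ N]

/-- The components of a one-form at `y` in the preferred chart at `x`. -/
def formCoord (α : OneForm I N) (x y : N) : F →L[ℝ] ℝ :=
  (show Cotangent I y from α y).comp ((trivializationAt F (TangentSpace I) x).symmL ℝ y)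

theorem coordExtend_eq_chartCovector (x : N) (ξ : Cotangent I x) (y : N) :
    coordExtend I x ξ y =
      chartCovector I x (ξ.comp ((trivializationAt F (TangentSpace I) x).symmL ℝ x)) y := rfl

theorem chartCovector_symmL {x y : N} (hy : y ∈ (chartAt H x).source) (ξ : Cotangent I y) :
    chartCovector I x (ξ.comp ((trivializationAt F (TangentSpace I) x).symmL ℝ y)) y = ξ := by
  ext v
  simp only [chartCovector, ContinuousLinearMap.comp_apply]
  rw [Trivialization.symmL_continuousLinearMapAt _ hy]

theorem coordExtend_self (x : N) (ξ : Cotangent I x) : coordExtend I x ξ x = ξ :=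
  chartCovector_symmL (mem_chart_source H x) ξ

theorem chartCovector_formCoord (α : OneForm I N) {x y : N} (hy : y ∈ (chartAt H x).source) :
    chartCovector I x (formCoord α x y) y = α y :=
  chartCovector_symmL hy _

theorem mdifferentiableAt_formCoord (α : OneForm I N) (x : N) :
    MDifferentiableAt I 𝓘(ℝ, F →L[ℝ] ℝ) (formCoord α x) x := by
  have h1 := α.contMDiff x
  rw [contMDiffAt_hom_bundle] at h1
  refine (h1.2.congr_of_eventuallyEq (Eventually.of_forall fun y => ?_)).mdifferentiableAt
    (by simp)
  ext v
  simp [formCoord, ContinuousLinearMap.inCoordinates]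

theorem coordDeriv_apply (α : OneForm I N) (x : N) (v : TangentSpace I x) :
    coordDeriv I α x v = chartCovector I x (mvfderiv I (formCoord α x) x v) x := rfl

theorem chartCovector_sum_smul {ι : Type*} (s : Finset ι) (c : ι → ℝ) (ξ : ι → F →L[ℝ] ℝ)
    (x y : N) : chartCovector I x (∑ r ∈ s, c r • ξ r) y =
      ∑ r ∈ s, c r • chartCovector I x (ξ r) y := by
  ext v
  simp [chartCovector]

theorem chartCovector_zero (x y : N) : chartCovector I x (0 : F →L[ℝ] ℝ) y = 0 := by
  ext v
  simp [chartCovector]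

theorem mdifferentiableAt_component {k : ℕ} (Q : multivectorField I N k) (x : N)
    (ξ : Fin k → F →L[ℝ] ℝ) :
    MDifferentiableAt I 𝓘(ℝ, ℝ) (fun y => Q.1 y fun i => chartCovector I x (ξ i) y) x :=
  ((Q.2 x ξ).contMDiffAt
    ((chartAt H x).open_source.mem_nhds (mem_chart_source H x))).mdifferentiableAt (by simp)

omit [IsManifold I ∞ N] in
theorem mdifferentiableAt_sum_smul {G : Type*} [NormedAddCommGroup G] [NormedSpace ℝ G] {ι : Type}
    (s : Finset ι) {c : ι → N → ℝ} (e : ι → G) {x : N}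
    (hc : ∀ i, MDifferentiableAt I 𝓘(ℝ, ℝ) (c i) x) :
    MDifferentiableAt I 𝓘(ℝ, G) (fun y => ∑ i ∈ s, c i y • e i) x := by
  have h : ∀ i ∈ s, MDifferentiableAt I 𝓘(ℝ, G) (fun y => c i y • e i) x := fun i _ =>
    (hc i).smul (mdifferentiableAt_const (c := e i))
  refine (MDifferentiableAt.sum (f := fun i y => c i y • e i) h).congr_of_eventuallyEq
    (Eventually.of_forall fun y => ?_)
  simp

variable [FiniteDimensional ℝ F]

/-- The product rule needs a map into one fixed normed space. Expanding covectors in a dual basis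
makes `C` a finite sum of component functions times fixed monomials. Alternation is not imposed, so
that the result also serves for bilinear forms. -/
theorem exists_multilinear_components {k : ℕ}
    (Q : ∀ y : N, MultilinearMap ℝ (fun _ : Fin k => Cotangent I y) ℝ) {x : N}
    (hQ : ∀ ξ : Fin k → F →L[ℝ] ℝ,
      MDifferentiableAt I 𝓘(ℝ, ℝ) (fun y => Q y fun i => chartCovector I x (ξ i) y) x) :
    ∃ C : N → ContinuousMultilinearMap ℝ (fun _ : Fin k => F →L[ℝ] ℝ) ℝ,
      MDifferentiableAt I 𝓘(ℝ, ContinuousMultilinearMap ℝ (fun _ : Fin k => F →L[ℝ] ℝ) ℝ) C x ∧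
      ∀ y ξ, C y ξ = Q y fun i => chartCovector I x (ξ i) y := by
  let b := Module.finBasis ℝ F
  let e : (Fin k → Fin (Module.finrank ℝ F)) →
      ContinuousMultilinearMap ℝ (fun _ : Fin k => F →L[ℝ] ℝ) ℝ := fun s =>
    (ContinuousMultilinearMap.mkPiAlgebra ℝ (Fin k) ℝ).compContinuousLinearMap
      fun i => ContinuousLinearMap.apply ℝ ℝ (b (s i))
  let d : Fin (Module.finrank ℝ F) → F →L[ℝ] ℝ := fun r =>
    LinearMap.toContinuousLinearMap (b.coord r)
  have hd : ∀ ξ : F →L[ℝ] ℝ, ξ = ∑ r, ξ (b r) • d r := by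
    intro ξ
    ext v
    conv_lhs => rw [← b.sum_repr v, map_sum]
    simp [d, mul_comm]
  refine ⟨fun y => ∑ s, (Q y fun i => chartCovector I x (d (s i)) y) • e s, ?_, ?_⟩
  · exact mdifferentiableAt_sum_smul _ e fun s => hQ fun i => d (s i)
  · intro y ξ
    have h1 : (fun i => chartCovector I x (ξ i) y) =
        fun i => ∑ r, (ξ i (b r)) • chartCovector I x (d r) y := by
      funext i
      rw [← chartCovector_sum_smul, ← hd]
    rw [h1, MultilinearMap.map_sum, sum_apply]
    refine Finset.sum_congr rfl fun s _ => ?_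
    rw [MultilinearMap.map_smul_univ]
    simp [e, mul_comm]

/-- The derivative of `Q (α₁, …, α_k)` in terms of the derivatives of `Q` and of the `αᵢ` in the
preferred chart. -/
theorem mvfderiv_eval_forms {k : ℕ}
    (Q : ∀ y : N, MultilinearMap ℝ (fun _ : Fin k => Cotangent I y) ℝ) {x : N}
    (hQ : ∀ ξ : Fin k → F →L[ℝ] ℝ,
      MDifferentiableAt I 𝓘(ℝ, ℝ) (fun y => Q y fun i => chartCovector I x (ξ i) y) x)
    (α : Fin k → OneForm I N) (v : TangentSpace I x) :
    mvfderiv I (fun y => Q y fun i => α i y) x v =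
      mvfderiv I (fun y => Q y fun i => coordExtend I x (α i x) y) x v +
        ∑ i, Q x (Function.update (fun l => (α l x : Cotangent I x)) i
          (coordDeriv I (α i) x v)) := by
  obtain ⟨C, hC, hCQ⟩ := exists_multilinear_components Q hQ
  have h1 : (fun y => Q y fun i => α i y) =ᶠ[𝓝 x] fun y => C y fun i => formCoord (α i) x y := by
    filter_upwards [(chartAt H x).open_source.mem_nhds (mem_chart_source H x)] with y hy
    rw [hCQ]
    congr 1
    funext i
    exact (chartCovector_formCoord (α i) hy).symm
  rw [mvfderiv_congr h1,
    mvfderiv_multilinear_apply hC fun i => mdifferentiableAt_formCoord (α i) x]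
  congr 1
  · simp only [hCQ]
    rfl
  · refine Finset.sum_congr rfl fun i _ => ?_
    rw [hCQ]
    congr 1
    funext l
    by_cases hl : l = i
    · subst hl
      simp [coordDeriv_apply]
    · simp only [Function.update_of_ne hl]
      exact chartCovector_formCoord (α l) (mem_chart_source H x)

/-- The alternating sum of the derivatives at `x` of a multivector field evaluated on the constant
extensions of the given covectors. -/
def localDifferential (ρ : ∀ x : N, Cotangent I x →ₗ[ℝ] TangentSpace I x) {k : ℕ}
    (Q : RawMultivectorField I N k) (x : N) (ξ : Fin (k + 1) → Cotangent I x) : ℝ :=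
  ∑ j : Fin (k + 1), (-1) ^ (j : ℕ) *
    mvfderiv I (fun y => Q y fun l => coordExtend I x (ξ (j.succAbove l)) y) x (ρ x (ξ j))

/-- The part of a bracket of one-forms that does not involve their derivatives. -/
def bracketTorsion (ρ : ∀ x : N, Cotangent I x →ₗ[ℝ] TangentSpace I x)
    (br : OneForm I N → OneForm I N → ∀ x : N, Cotangent I x) (α β : OneForm I N) (x : N) :
    Cotangent I x :=
  br α β x - (coordDeriv I β x (ρ x (α x)) - coordDeriv I α x (ρ x (β x)))

/-- The product rule produces derivatives of the forms, which cancel against the part of the bracket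
built from `coordDeriv`. The forms then enter only through their values at `x` and the torsion. -/
theorem algebroidDifferential_apply (ρ : ∀ x : N, Cotangent I x →ₗ[ℝ] TangentSpace I x)
    (br : OneForm I N → OneForm I N → ∀ x : N, Cotangent I x) {k : ℕ}
    (Q : multivectorField I N k) (α : Fin (k + 1) → OneForm I N) (x : N) :
    algebroidDifferential I ρ br k Q α x =
      localDifferential ρ Q.1 x (fun j => α j x) +
      ∑ j : Fin (k + 1), ∑ i : Fin k with i.castSucc < j, (-1) ^ (j : ℕ) *
        Q.1 x (Function.update (fun l => (α (j.succAbove l) x : Cotangent I x)) i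
          (bracketTorsion ρ br (α i.castSucc) (α j) x)) := by
  have h1 : ∀ j : Fin (k + 1),
      mvfderiv I (fun y => Q.1 y fun l => α (j.succAbove l) y) x (ρ x (α j x)) =
      mvfderiv I (fun y => Q.1 y fun l => coordExtend I x (α (j.succAbove l) x) y) x
        (ρ x (α j x)) + ∑ i, Q.1 x (Function.update
          (fun l => (α (j.succAbove l) x : Cotangent I x)) i
          (coordDeriv I (α (j.succAbove i)) x (ρ x (α j x)))) := fun j =>
    mvfderiv_eval_forms (fun y => (Q.1 y).toMultilinearMap) (mdifferentiableAt_component Q x)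
      (fun l => α (j.succAbove l)) _
  have h2 := alternatingMap_sum_update_cancel (Q.1 x) (fun j => (α j x : Cotangent I x))
    (fun i j => coordDeriv I (α j) x (ρ x (α i x)))
  change ∑ j : Fin (k + 1), (-1) ^ (j : ℕ) *
        mvfderiv I (fun y => Q.1 y fun l => α (j.succAbove l) y) x (ρ x (α j x)) +
      ∑ j : Fin (k + 1), ∑ i : Fin k with i.castSucc < j, (-1) ^ (j : ℕ) *
        Q.1 x (Function.update (fun l => (α (j.succAbove l) x : Cotangent I x)) i
          (br (α i.castSucc) (α j) x)) = _
  simp only [h1, mul_add, Finset.sum_add_distrib, bracketTorsion, AlternatingMap.map_update_sub,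
    mul_sub, Finset.sum_sub_distrib, localDifferential] at h2 ⊢
  linarith

end General

/-! ### Global one-forms with given values; the torsion of the Koszul bracket. -/

section General

variable {F : Type*} [NormedAddCommGroup F] [NormedSpace ℝ F]
  {H : Type*} [TopologicalSpace H] {I : ModelWithCorners ℝ F H}
  {N : Type*} [TopologicalSpace N] [ChartedSpace H N] [IsManifold I ∞ N]

/-- A covector extends to a global one-form as soon as there is a smooth function that is `1` at its
base point and supported in the chart there. -/
theorem exists_oneForm_eq {x : N} {f : N → ℝ} (hf : ContMDiff I 𝓘(ℝ, ℝ) ∞ f)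
    (hsupp : tsupport f ⊆ (chartAt H x).source) (hfx : f x = 1) (ξ : Cotangent I x) :
    ∃ α : OneForm I N, α x = ξ := by
  let s : ∀ y : N, TangentSpace I y →L[ℝ] Bundle.Trivial N ℝ y := fun y =>
    f y • (coordExtend I x ξ y : Cotangent I y)
  have hs : ContMDiff I (I.prod 𝓘(ℝ, F →L[ℝ] ℝ)) ∞
      fun y => TotalSpace.mk' (F →L[ℝ] ℝ) (E := fun y : N =>
        TangentSpace I y →L[ℝ] Bundle.Trivial N ℝ y) y (s y) := by
    intro y
    by_cases hy : y ∈ (chartAt H x).source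
    · rw [(trivializationAt (F →L[ℝ] ℝ)
        (fun y : N => TangentSpace I y →L[ℝ] Bundle.Trivial N ℝ y) x).contMDiffAt_section_iff
          (by simpa [hom_trivializationAt_baseSet] using hy)]
      have h1 : ContMDiffAt I 𝓘(ℝ, F →L[ℝ] ℝ) ∞ (fun z => f z •
        (ξ.comp ((trivializationAt F (TangentSpace I) x).symmL ℝ x) : F →L[ℝ] ℝ)) y :=
        (hf y).smul contMDiffAt_const
      refine h1.congr_of_eventuallyEq ?_
      filter_upwards [(chartAt H x).open_source.mem_nhds hy] with z hz
      rw [hom_trivializationAt_apply]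
      ext v
      have h2 : (trivializationAt F (TangentSpace I) x).continuousLinearMapAt ℝ z
          ((trivializationAt F (TangentSpace I) x).symmL ℝ z v) = v :=
        Trivialization.continuousLinearMapAt_symmL _ hz v
      have h3 : s z ((trivializationAt F (TangentSpace I) x).symmL ℝ z v) =
          f z • ξ ((trivializationAt F (TangentSpace I) x).symmL ℝ x v) := by
        change f z • ξ ((trivializationAt F (TangentSpace I) x).symmL ℝ x
          ((trivializationAt F (TangentSpace I) x).continuousLinearMapAt ℝ z
          ((trivializationAt F (TangentSpace I) x).symmL ℝ z v))) = _
        rw [h2]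
      simpa [ContinuousLinearMap.inCoordinates] using h3
    -- Outside the chart domain the point is off the support of `f`, so `s` agrees locally with the
    -- zero section.
    · have h0 : ∀ᶠ z in 𝓝 y, s z = 0 := by
        have : y ∉ tsupport f := fun h => hy (hsupp h)
        filter_upwards [notMem_tsupport_iff_eventuallyEq.1 this] with z hz
        simp [s, hz]
      have h1 := (contMDiff_zeroSection ℝ (n := ∞) (IB := I) (F := F →L[ℝ] ℝ)
        (fun y : N => TangentSpace I y →L[ℝ] Bundle.Trivial N ℝ y)) y
      refine h1.congr_of_eventuallyEq ?_
      filter_upwards [h0] with z hz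
      rw [hz]
      rfl
  refine ⟨⟨s, hs⟩, ?_⟩
  change f x • coordExtend I x ξ x = ξ
  rw [hfx, one_smul, coordExtend_self]

variable [FiniteDimensional ℝ F]

/-- The product rule for a field of bilinear forms on the cotangent spaces. -/
theorem mvfderiv_bilin_forms (P : ∀ x : N, LinearMap.BilinForm ℝ (Cotangent I x)) {x : N}
    (hP : ∀ ξ η : F →L[ℝ] ℝ, MDifferentiableAt I 𝓘(ℝ, ℝ)
      (fun y => P y (chartCovector I x ξ y) (chartCovector I x η y)) x)
    (φ ψ : OneForm I N) (v : TangentSpace I x) :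
    mvfderiv I (fun y => P y (φ y) (ψ y)) x v =
      mvfderiv I (fun y => P y (coordExtend I x (φ x) y) (coordExtend I x (ψ x) y)) x v +
        P x (coordDeriv I φ x v) (ψ x) + P x (φ x) (coordDeriv I ψ x v) := by
  let Q : ∀ y : N, MultilinearMap ℝ (fun _ : Fin 2 => Cotangent I y) ℝ := fun y =>
    MultilinearMap.mk' (fun ξ => P y (ξ 0) (ξ 1))
      (fun ξ i a b => by fin_cases i <;> simp)
      (fun ξ i c a => by fin_cases i <;> simp)
  have h := mvfderiv_eval_forms Q (x := x) (fun ξ => hP (ξ 0) (ξ 1)) ![φ, ψ] v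
  simpa [Q, Fin.sum_univ_two, add_assoc] using h

/-- By skew-symmetry the three exact terms of the bracket add up to one copy of `d(P(φ, ψ))`. Its
product rule expansion cancels the transposed halves of `dψ` and `dφ`, leaving the derivative of the
components of `P`. -/
theorem bracketTorsion_koszulBracket (P : ∀ x : N, LinearMap.BilinForm ℝ (Cotangent I x)) {x : N}
    (hskew : ∀ y ξ η, P y ξ η = - P y η ξ)
    (hP : ∀ ξ η : F →L[ℝ] ℝ, MDifferentiableAt I 𝓘(ℝ, ℝ)
      (fun y => P y (chartCovector I x ξ y) (chartCovector I x η y)) x)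
    (φ ψ : OneForm I N) (v : TangentSpace I x) :
    bracketTorsion (fun x => sharp (P x)) (koszulBracket I P) φ ψ x v =
      mvfderiv I (fun y => P y (coordExtend I x (φ x) y) (coordExtend I x (ψ x) y)) x v := by
  have hd : ∀ (α : OneForm I N) (w : TangentSpace I x),
      dForm I α x w v = coordDeriv I α x w v - coordDeriv I α x v w := fun _ _ => rfl
  have h1 : ∀ α β : OneForm I N, (fun y => (β y (sharp (P y) (α y)) : ℝ)) =
      fun y => P y (α y) (β y) := fun α β => funext fun y => apply_sharp (P y) (α y) (β y)
  have h2 : mvfderiv I (fun y => P y (ψ y) (φ y)) x v =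
      - mvfderiv I (fun y => P y (φ y) (ψ y)) x v := by
    have : (fun y => P y (ψ y) (φ y)) = - fun y => P y (φ y) (ψ y) :=
      funext fun y => hskew y _ _
    rw [this, mvfderiv_neg]
    rfl
  have h3 := mvfderiv_bilin_forms P hP φ ψ v
  have h4 : P x (φ x) (coordDeriv I ψ x v) = coordDeriv I ψ x v (sharp (P x) (φ x)) :=
    (apply_sharp (P x) _ _).symm
  have h5 : P x (coordDeriv I φ x v) (ψ x) = - coordDeriv I φ x v (sharp (P x) (ψ x)) := by
    rw [hskew, apply_sharp]
  have h6 : koszulBracket I P φ ψ x v =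
      (mvfderiv I (fun y => (ψ y (sharp (P y) (φ y)) : ℝ)) x v + dForm I ψ x (sharp (P x) (φ x)) v) -
      (mvfderiv I (fun y => (φ y (sharp (P y) (ψ y)) : ℝ)) x v + dForm I φ x (sharp (P x) (ψ x)) v) -
      mvfderiv I (fun y => P y (φ y) (ψ y)) x v := rfl
  have h7 : bracketTorsion (fun x => sharp (P x)) (koszulBracket I P) φ ψ x v =
      koszulBracket I P φ ψ x v - (coordDeriv I ψ x (sharp (P x) (φ x)) v -
        coordDeriv I φ x (sharp (P x) (ψ x)) v) := rfl
  rw [h7, h6, h1, h1, hd, hd, h2]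
  linarith

end General

/-! ### Chart components of tangent vectors. -/

section General

variable {F : Type*} [NormedAddCommGroup F] [NormedSpace ℝ F]
  {H : Type*} [TopologicalSpace H] (I : ModelWithCorners ℝ F H)
  {N : Type*} [TopologicalSpace N] [ChartedSpace H N] [IsManifold I ∞ N]

/-- The components of tangent vectors at `y` in the preferred chart at `x`. -/
abbrev chartMap (x y : N) : TangentSpace I y →L[ℝ] F :=
  (trivializationAt F (TangentSpace I) x).continuousLinearMapAt ℝ y

/-- The tangent vectors at `y` with given components in the preferred chart at `x`. -/
abbrev chartMapSymm (x y : N) : F →L[ℝ] TangentSpace I y :=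
  (trivializationAt F (TangentSpace I) x).symmL ℝ y

variable {I}

theorem chartMapSymm_chartMap {x y : N} (hy : y ∈ (chartAt H x).source) (v : TangentSpace I y) :
    chartMapSymm I x y (chartMap I x y v) = v :=
  Trivialization.symmL_continuousLinearMapAt _ hy v

theorem chartMap_chartMapSymm {x y : N} (hy : y ∈ (chartAt H x).source) (e : F) :
    chartMap I x y (chartMapSymm I x y e) = e :=
  Trivialization.continuousLinearMapAt_symmL _ hy e

theorem trivializationAt_snd {x : N} (z : TangentBundle I N) (hz : z.1 ∈ (chartAt H x).source) :
    (trivializationAt F (TangentSpace I) x z).2 = chartMap I x z.1 z.2 := by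
  rw [chartMap, Trivialization.continuousLinearMapAt_apply, Trivialization.coe_linearMapAt_of_mem]
  exact hz

end General

/-! ### Horizontal and vertical lifts in the charts of `TM`. -/

section Affine

variable {E : Type*} [NormedAddCommGroup E] [NormedSpace ℝ E]
  {M : Type*} [TopologicalSpace M] [ChartedSpace E M] [HasGroupoid M (affineGroupoid E)]

/-- The derivatives of the transition maps of an affine manifold are locally constant. -/
theorem eventually_chartMap_chartMapSymm_eq (x y₀ : M) (hy₀ : y₀ ∈ (chartAt E x).source) (c : E) :
    ∀ᶠ y in 𝓝 y₀, chartMap 𝓘(ℝ, E) x y (chartMapSymm 𝓘(ℝ, E) y₀ y c) =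
      chartMap 𝓘(ℝ, E) x y₀ (chartMapSymm 𝓘(ℝ, E) y₀ y₀ c) := by
  have hg : (chartAt E y₀).symm ≫ₕ chartAt E x ∈ affineGroupoid E :=
    HasGroupoid.compatible (chart_mem_atlas E y₀) (chart_mem_atlas E x)
  obtain ⟨A, hA⟩ := hg.1 (chartAt E y₀ y₀) (by simp [hy₀])
  have h1 : ∀ᶠ y in 𝓝 y₀, chartMap 𝓘(ℝ, E) x y (chartMapSymm 𝓘(ℝ, E) y₀ y c) =
      A.contLinear c := by
    have hc : Tendsto (chartAt E y₀) (𝓝 y₀) (𝓝 (chartAt E y₀ y₀)) :=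
      (chartAt E y₀).continuousAt (mem_chart_source E y₀)
    -- The transition map agrees with `A` near each nearby point, so its derivative there is the
    -- linear part of `A`.
    filter_upwards [hc.eventually (eventually_eventually_nhds.2 hA),
      (chartAt E y₀).open_source.mem_nhds (mem_chart_source E y₀),
      (chartAt E x).open_source.mem_nhds hy₀] with y h2 h3 h4
    have h5 : chartMap 𝓘(ℝ, E) x y (chartMapSymm 𝓘(ℝ, E) y₀ y c) =
        tangentCoordChange 𝓘(ℝ, E) y₀ x y c := by
      rw [chartMap, chartMapSymm, TangentBundle.continuousLinearMapAt_trivializationAt_eq_core h4,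
        TangentBundle.symmL_trivializationAt_eq_core h3]
      exact tangentCoordChange_comp (I := 𝓘(ℝ, E)) (w := y₀) (x := y) (y := x) (z := y)
        (by simp [h3, h4])
    rw [h5, tangentCoordChange_def]
    have h6 : (extChartAt 𝓘(ℝ, E) x ∘ (extChartAt 𝓘(ℝ, E) y₀).symm)
        =ᶠ[𝓝 (extChartAt 𝓘(ℝ, E) y₀ y)] A := by
      simpa using! h2
    have h7 : fderivWithin ℝ (extChartAt 𝓘(ℝ, E) x ∘ (extChartAt 𝓘(ℝ, E) y₀).symm)
        (range 𝓘(ℝ, E)) (extChartAt 𝓘(ℝ, E) y₀ y) = A.contLinear := by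
      rw [modelWithCornersSelf_coe, range_id, fderivWithin_univ, h6.fderiv_eq]
      exact A.hasFDerivAt.fderiv
    rw [h7]
  filter_upwards [h1] with y hy
  rw [hy, h1.self_of_nhds]

/-- The differential of the projection `TM → M`. -/
abbrev dProj (z : TangentBundle 𝓘(ℝ, E) M) :
    TangentSpace 𝓘(ℝ, E).tangent z →L[ℝ] TangentSpace 𝓘(ℝ, E) z.1 :=
  mfderiv 𝓘(ℝ, E).tangent 𝓘(ℝ, E) (fun w : TangentBundle 𝓘(ℝ, E) M => w.1) z

theorem mdifferentiableAt_tangent_proj (z : TangentBundle 𝓘(ℝ, E) M) :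
    MDifferentiableAt 𝓘(ℝ, E).tangent 𝓘(ℝ, E) (fun w : TangentBundle 𝓘(ℝ, E) M => w.1) z :=
  Bundle.mdifferentiableAt_proj (TangentSpace 𝓘(ℝ, E))

/-- `verticalLift` is an `mfderiv`, which is `0` by default; this shows that it is a true
differential. In the trivialization the inclusion of the fibre is linear. -/
theorem hasMFDerivAt_fibre_inclusion (x : M) (u : E) :
    HasMFDerivAt 𝓘(ℝ, E) 𝓘(ℝ, E).tangent (fun w : E => (⟨x, w⟩ : TangentBundle 𝓘(ℝ, E) M)) u
      (verticalLift (⟨x, u⟩ : TangentBundle 𝓘(ℝ, E) M)) := by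
  refine MDifferentiableAt.hasMFDerivAt ?_
  rw [mdifferentiableAt_totalSpace]
  refine ⟨mdifferentiableAt_const, ?_⟩
  let L : E →L[ℝ] E := chartMap 𝓘(ℝ, E) x x
  have : MDifferentiableAt 𝓘(ℝ, E) 𝓘(ℝ, E) L u := L.differentiableAt.mdifferentiableAt
  refine this.congr_of_eventuallyEq (Eventually.of_forall fun w => ?_)
  exact trivializationAt_snd (⟨x, w⟩ : TangentBundle 𝓘(ℝ, E) M) (mem_chart_source E x)

/-- The local vector field on `M` that is parallel with value `z` at the base point of `z`. -/
abbrev parallelSection (z : TangentBundle 𝓘(ℝ, E) M) (y : M) : TangentBundle 𝓘(ℝ, E) M :=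
  ⟨y, chartMapSymm 𝓘(ℝ, E) z.1 y (chartMap 𝓘(ℝ, E) z.1 z.1 z.2)⟩

theorem parallelSection_self (z : TangentBundle 𝓘(ℝ, E) M) : parallelSection z z.1 = z := by
  rw [parallelSection, chartMapSymm_chartMap (mem_chart_source E z.1)]

theorem mdifferentiableAt_parallelSection (z : TangentBundle 𝓘(ℝ, E) M) :
    MDifferentiableAt 𝓘(ℝ, E) 𝓘(ℝ, E).tangent (parallelSection z) z.1 := by
  rw [mdifferentiableAt_totalSpace]
  refine ⟨mdifferentiableAt_id, ?_⟩
  refine (mdifferentiableAt_const (c := chartMap 𝓘(ℝ, E) z.1 z.1 z.2)).congr_of_eventuallyEq ?_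
  filter_upwards [(chartAt E z.1).open_source.mem_nhds (mem_chart_source E z.1)] with y hy
  refine (trivializationAt_snd (parallelSection z y) hy).trans ?_
  exact chartMap_chartMapSymm hy _

theorem dProj_verticalLift (z : TangentBundle 𝓘(ℝ, E) M) (v : TangentSpace 𝓘(ℝ, E) z.1) :
    dProj z (verticalLift z v) = 0 := by
  obtain ⟨x, u⟩ := z
  have key : ∀ u : E, dProj (⟨x, u⟩ : TangentBundle 𝓘(ℝ, E) M)
      (verticalLift (⟨x, u⟩ : TangentBundle 𝓘(ℝ, E) M) v) = 0 := fun u =>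
    DFunLike.congr_fun (hasMFDerivAt_unique
      ((mdifferentiableAt_tangent_proj _).hasMFDerivAt.comp u (hasMFDerivAt_fibre_inclusion x u))
      (hasMFDerivAt_const (I := 𝓘(ℝ, E)) (I' := 𝓘(ℝ, E)) x u)) v
  exact key u

theorem dProj_horizontalLift (z : TangentBundle 𝓘(ℝ, E) M) (v : TangentSpace 𝓘(ℝ, E) z.1) :
    dProj z (horizontalLift z v) = v := by
  have h := mfderiv_comp_apply_of_eq (I := 𝓘(ℝ, E)) (I' := 𝓘(ℝ, E).tangent) (I'' := 𝓘(ℝ, E)) z.1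
    (mdifferentiableAt_tangent_proj z) (mdifferentiableAt_parallelSection z)
    (parallelSection_self z) v
  refine h.symm.trans ?_
  change mfderiv 𝓘(ℝ, E) 𝓘(ℝ, E) (id : M → M) z.1 v = v
  rw [mfderiv_id]
  rfl

theorem mem_tangent_chart_source {z z' : TangentBundle 𝓘(ℝ, E) M}
    (hz : z'.1 ∈ (chartAt E z.1).source) : z' ∈ (chartAt (ModelProd E E) z).source :=
  (TangentBundle.mem_chart_source_iff z' z).2 hz

theorem extChartAt_tangent_apply {z z' : TangentBundle 𝓘(ℝ, E) M}
    (hz : z'.1 ∈ (chartAt E z.1).source) :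
    extChartAt 𝓘(ℝ, E).tangent z z' =
      (extChartAt 𝓘(ℝ, E) z.1 z'.1, chartMap 𝓘(ℝ, E) z.1 z'.1 z'.2) := by
  rw [← trivializationAt_snd z' hz]
  rfl

theorem chartMap_verticalLift {z z' : TangentBundle 𝓘(ℝ, E) M}
    (hz : z'.1 ∈ (chartAt E z.1).source) (v : TangentSpace 𝓘(ℝ, E) z'.1) :
    chartMap 𝓘(ℝ, E).tangent z z' (verticalLift z' v) = (0, chartMap 𝓘(ℝ, E) z.1 z'.1 v) := by
  obtain ⟨x, u⟩ := z'
  have key : ∀ u : E, chartMap 𝓘(ℝ, E).tangent z (⟨x, u⟩ : TangentBundle 𝓘(ℝ, E) M)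
      (verticalLift (⟨x, u⟩ : TangentBundle 𝓘(ℝ, E) M) v) = (0, chartMap 𝓘(ℝ, E) z.1 x v) := by
    intro u
    have hz' : (⟨x, u⟩ : TangentBundle 𝓘(ℝ, E) M) ∈ (chartAt (ModelProd E E) z).source :=
      mem_tangent_chart_source hz
    rw [chartMap, TangentBundle.continuousLinearMapAt_trivializationAt hz']
    have h := (mdifferentiableAt_extChartAt (I := 𝓘(ℝ, E).tangent) hz').hasMFDerivAt.comp u
      (hasMFDerivAt_fibre_inclusion x u)
    have h2 : extChartAt 𝓘(ℝ, E).tangent z ∘ (fun w : E => (⟨x, w⟩ : TangentBundle 𝓘(ℝ, E) M)) =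
        fun w : E => (extChartAt 𝓘(ℝ, E) z.1 x, (chartMap 𝓘(ℝ, E) z.1 x : E →L[ℝ] E) w) :=
      funext fun w => extChartAt_tangent_apply (z' := ⟨x, w⟩) hz
    have h3 := ((hasFDerivAt_const (extChartAt 𝓘(ℝ, E) z.1 x) u).prodMk
      (chartMap 𝓘(ℝ, E) z.1 x : E →L[ℝ] E).hasFDerivAt).hasMFDerivAt
    exact DFunLike.congr_fun
      (hasMFDerivAt_unique h (h3.congr_of_eventuallyEq (EventuallyEq.of_eq h2))) v
  exact key u

/-- This is where affineness enters: a section with constant components in the chart at `z'.1` has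
locally constant components in the chart at `z.1`, so the fibre component of its derivative
vanishes. -/
theorem chartMap_horizontalLift {z z' : TangentBundle 𝓘(ℝ, E) M}
    (hz : z'.1 ∈ (chartAt E z.1).source) (v : TangentSpace 𝓘(ℝ, E) z'.1) :
    chartMap 𝓘(ℝ, E).tangent z z' (horizontalLift z' v) = (chartMap 𝓘(ℝ, E) z.1 z'.1 v, 0) := by
  have hz' := mem_tangent_chart_source hz
  rw [chartMap, TangentBundle.continuousLinearMapAt_trivializationAt hz']
  have h := mfderiv_comp_apply_of_eq (I := 𝓘(ℝ, E)) (I' := 𝓘(ℝ, E).tangent)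
    (I'' := 𝓘(ℝ, E × E)) z'.1
    (mdifferentiableAt_extChartAt (I := 𝓘(ℝ, E).tangent) hz')
    (mdifferentiableAt_parallelSection z') (parallelSection_self z') v
  refine h.symm.trans ?_
  have h2 : extChartAt 𝓘(ℝ, E).tangent z ∘ parallelSection z' =ᶠ[𝓝 z'.1]
      fun y => (extChartAt 𝓘(ℝ, E) z.1 y, chartMap 𝓘(ℝ, E) z.1 z'.1
        (chartMapSymm 𝓘(ℝ, E) z'.1 z'.1 (chartMap 𝓘(ℝ, E) z'.1 z'.1 z'.2))) := by
    filter_upwards [(chartAt E z.1).open_source.mem_nhds hz,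
      eventually_chartMap_chartMapSymm_eq z.1 z'.1 hz (chartMap 𝓘(ℝ, E) z'.1 z'.1 z'.2)]
      with y hy hy2
    rw [← hy2]
    exact extChartAt_tangent_apply (z' := parallelSection z' y) hy
  have h3 := (mdifferentiableAt_extChartAt (I := 𝓘(ℝ, E)) hz).hasMFDerivAt
  have h4 : HasMFDerivAt 𝓘(ℝ, E) 𝓘(ℝ, E × E) (fun y => (extChartAt 𝓘(ℝ, E) z.1 y,
        chartMap 𝓘(ℝ, E) z.1 z'.1
        (chartMapSymm 𝓘(ℝ, E) z'.1 z'.1 (chartMap 𝓘(ℝ, E) z'.1 z'.1 z'.2)))) z'.1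
      ((chartMap 𝓘(ℝ, E) z.1 z'.1 : E →L[ℝ] E).prod (0 : E →L[ℝ] E)) := by
    rw [← TangentBundle.continuousLinearMapAt_trivializationAt hz] at h3
    exact ⟨h3.1.prodMk continuousAt_const, h3.2.prodMk (hasFDerivWithinAt_const _ _ _)⟩
  exact DFunLike.congr_fun (h4.congr_of_eventuallyEq h2).mfderiv v

end Affine

/-! ### Splitting covectors on `TM`; the anchor of `Π`. -/

section General

variable {F : Type*} [NormedAddCommGroup F] [NormedSpace ℝ F]
  {H : Type*} [TopologicalSpace H] {I : ModelWithCorners ℝ F H}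
  {N : Type*} [TopologicalSpace N] [ChartedSpace H N] [IsManifold I ∞ N]

theorem coordExtend_chartCovector (x y : N) (η : F →L[ℝ] ℝ) :
    coordExtend I x (chartCovector I x η x) y = chartCovector I x η y := by
  rw [coordExtend_eq_chartCovector]
  congr 1
  ext e
  exact congrArg η (chartMap_chartMapSymm (mem_chart_source H x) e)

theorem coordExtend_zero (x y : N) : coordExtend I x 0 y = 0 := by
  rw [coordExtend_eq_chartCovector, ContinuousLinearMap.zero_comp, chartCovector_zero]

end General

section Affine

variable {E : Type*} [NormedAddCommGroup E] [NormedSpace ℝ E]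
  {M : Type*} [TopologicalSpace M] [ChartedSpace E M] [HasGroupoid M (affineGroupoid E)]

theorem chartCovector_comp_verticalLift {z z' : TangentBundle 𝓘(ℝ, E) M}
    (hz : z'.1 ∈ (chartAt E z.1).source) (ξ : E × E →L[ℝ] ℝ) :
    (chartCovector 𝓘(ℝ, E).tangent z ξ z').comp (verticalLift z') =
      chartCovector 𝓘(ℝ, E) z.1 (ξ.comp (ContinuousLinearMap.inr ℝ E E)) z'.1 := by
  ext v
  exact congrArg ξ (chartMap_verticalLift hz v)

theorem chartCovector_comp_horizontalLift {z z' : TangentBundle 𝓘(ℝ, E) M}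
    (hz : z'.1 ∈ (chartAt E z.1).source) (ξ : E × E →L[ℝ] ℝ) :
    (chartCovector 𝓘(ℝ, E).tangent z ξ z').comp (horizontalLift z') =
      chartCovector 𝓘(ℝ, E) z.1 (ξ.comp (ContinuousLinearMap.inl ℝ E E)) z'.1 := by
  ext v
  exact congrArg ξ (chartMap_horizontalLift hz v)

/-- Taking vertical parts commutes with extension by constant components, because lifts are constant
in charts. This reduces local differentials on `TM` to those on `M`. -/
theorem coordExtend_comp_verticalLift {z z' : TangentBundle 𝓘(ℝ, E) M}
    (hz : z'.1 ∈ (chartAt E z.1).source) (φ : Cotangent 𝓘(ℝ, E).tangent z) :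
    (coordExtend 𝓘(ℝ, E).tangent z φ z').comp (verticalLift z') =
      coordExtend 𝓘(ℝ, E) z.1 (φ.comp (verticalLift z)) z'.1 := by
  conv_rhs => rw [← coordExtend_self z φ]
  rw [coordExtend_eq_chartCovector, coordExtend_eq_chartCovector z,
    chartCovector_comp_verticalLift hz, chartCovector_comp_verticalLift (mem_chart_source E z.1),
    coordExtend_chartCovector]

theorem coordExtend_comp_horizontalLift {z z' : TangentBundle 𝓘(ℝ, E) M}
    (hz : z'.1 ∈ (chartAt E z.1).source) (φ : Cotangent 𝓘(ℝ, E).tangent z) :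
    (coordExtend 𝓘(ℝ, E).tangent z φ z').comp (horizontalLift z') =
      coordExtend 𝓘(ℝ, E) z.1 (φ.comp (horizontalLift z)) z'.1 := by
  conv_rhs => rw [← coordExtend_self z φ]
  rw [coordExtend_eq_chartCovector, coordExtend_eq_chartCovector z,
    chartCovector_comp_horizontalLift hz,
    chartCovector_comp_horizontalLift (mem_chart_source E z.1), coordExtend_chartCovector]

/-- The tangent vectors to `TM` are sums of horizontal and vertical vectors. -/
theorem exists_eq_horizontalLift_add_verticalLift (z : TangentBundle 𝓘(ℝ, E) M)
    (w : TangentSpace 𝓘(ℝ, E).tangent z) :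
    ∃ a b : TangentSpace 𝓘(ℝ, E) z.1, w = horizontalLift z a + verticalLift z b := by
  have hz := mem_chart_source E z.1
  have hz' := mem_tangent_chart_source (z := z) hz
  refine ⟨chartMapSymm 𝓘(ℝ, E) z.1 z.1 (chartMap 𝓘(ℝ, E).tangent z z w).1,
    chartMapSymm 𝓘(ℝ, E) z.1 z.1 (chartMap 𝓘(ℝ, E).tangent z z w).2, ?_⟩
  rw [← chartMapSymm_chartMap hz' w, ← chartMapSymm_chartMap hz' (_ + _)]
  congr 1
  rw [map_add, chartMap_horizontalLift hz, chartMap_verticalLift hz, chartMap_chartMapSymm hz,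
    chartMap_chartMapSymm hz, chartMapSymm_chartMap hz']
  simp

theorem covector_tangent_ext {z : TangentBundle 𝓘(ℝ, E) M} {φ ψ : Cotangent 𝓘(ℝ, E).tangent z}
    (hh : φ.comp (horizontalLift z) = ψ.comp (horizontalLift z))
    (hv : φ.comp (verticalLift z) = ψ.comp (verticalLift z)) : φ = ψ := by
  ext w
  obtain ⟨a, b, rfl⟩ := exists_eq_horizontalLift_add_verticalLift z w
  rw [map_add, map_add]
  exact congrArg₂ _ (DFunLike.congr_fun hh a) (DFunLike.congr_fun hv b)

/-- The connection map `T_z TM → T_{p z} M`: the projection to the vertical part. -/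
def connectionMap (z : TangentBundle 𝓘(ℝ, E) M) :
    TangentSpace 𝓘(ℝ, E).tangent z →L[ℝ] TangentSpace 𝓘(ℝ, E) z.1 :=
  (chartMapSymm 𝓘(ℝ, E) z.1 z.1).comp
    ((ContinuousLinearMap.snd ℝ E E).comp (chartMap 𝓘(ℝ, E).tangent z z))

/-- With the next lemma, this says that `ξ.comp (connectionMap z)` is the covector `ξᵛ`. -/
theorem comp_connectionMap_comp_verticalLift (z : TangentBundle 𝓘(ℝ, E) M)
    (ξ : Cotangent 𝓘(ℝ, E) z.1) : (ξ.comp (connectionMap z)).comp (verticalLift z) = ξ := by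
  ext v
  have hz := mem_chart_source E z.1
  change ξ (chartMapSymm 𝓘(ℝ, E) z.1 z.1
    (chartMap 𝓘(ℝ, E).tangent z z (verticalLift z v)).2) = ξ v
  rw [chartMap_verticalLift hz, chartMapSymm_chartMap hz]

theorem comp_connectionMap_comp_horizontalLift (z : TangentBundle 𝓘(ℝ, E) M)
    (ξ : Cotangent 𝓘(ℝ, E) z.1) : (ξ.comp (connectionMap z)).comp (horizontalLift z) = 0 := by
  ext v
  change ξ (chartMapSymm 𝓘(ℝ, E) z.1 z.1
    (chartMap 𝓘(ℝ, E).tangent z z (horizontalLift z v)).2) = 0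
  rw [chartMap_horizontalLift (mem_chart_source E z.1)]
  simp

theorem coordExtend_comp_connectionMap {z z' : TangentBundle 𝓘(ℝ, E) M}
    (hz : z'.1 ∈ (chartAt E z.1).source) (ξ : Cotangent 𝓘(ℝ, E) z.1) :
    coordExtend 𝓘(ℝ, E).tangent z (ξ.comp (connectionMap z)) z' =
      (coordExtend 𝓘(ℝ, E) z.1 ξ z'.1).comp (connectionMap z') := by
  apply covector_tangent_ext
  · rw [coordExtend_comp_horizontalLift hz, comp_connectionMap_comp_horizontalLift,
      comp_connectionMap_comp_horizontalLift, coordExtend_zero]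
  · rw [coordExtend_comp_verticalLift hz, comp_connectionMap_comp_verticalLift,
      comp_connectionMap_comp_verticalLift]

theorem chartCovector_comp_connectionMap {z z' : TangentBundle 𝓘(ℝ, E) M}
    (hz : z'.1 ∈ (chartAt E z.1).source) (ξ : E →L[ℝ] ℝ) :
    chartCovector 𝓘(ℝ, E).tangent z (ξ.comp (ContinuousLinearMap.snd ℝ E E)) z' =
      (chartCovector 𝓘(ℝ, E) z.1 ξ z'.1).comp (connectionMap z') := by
  apply covector_tangent_ext
  · rw [chartCovector_comp_horizontalLift hz, comp_connectionMap_comp_horizontalLift,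
      ContinuousLinearMap.comp_assoc, ContinuousLinearMap.snd_comp_inl,
      ContinuousLinearMap.comp_zero, chartCovector_zero]
  · rw [chartCovector_comp_verticalLift hz, comp_connectionMap_comp_verticalLift,
      ContinuousLinearMap.comp_assoc, ContinuousLinearMap.snd_comp_inr,
      ContinuousLinearMap.comp_id]

theorem eventually_proj_mem_chart_source (z : TangentBundle 𝓘(ℝ, E) M) :
    ∀ᶠ z' in 𝓝 z, z'.1 ∈ (chartAt E z.1).source :=
  (mdifferentiableAt_tangent_proj z).continuousAt.eventually
    ((chartAt E z.1).open_source.mem_nhds (mem_chart_source E z.1))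

variable {h : ∀ x : M, LinearMap.BilinForm ℝ (Cotangent 𝓘(ℝ, E) x)}

theorem tangentBivector_apply (z : TangentBundle 𝓘(ℝ, E) M)
    (φ ψ : Cotangent 𝓘(ℝ, E).tangent z) :
    tangentBivector h z φ ψ = h z.1 (φ.comp (horizontalLift z)) (ψ.comp (verticalLift z)) -
      h z.1 (ψ.comp (horizontalLift z)) (φ.comp (verticalLift z)) := rfl

theorem tangentBivector_skew (z : TangentBundle 𝓘(ℝ, E) M)
    (φ ψ : Cotangent 𝓘(ℝ, E).tangent z) :
    tangentBivector h z φ ψ = - tangentBivector h z ψ φ := by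
  rw [tangentBivector_apply, tangentBivector_apply]; ring

variable [FiniteDimensional ℝ E]

/-- Tested against `β`, the left side is `Π(φ, βʰ)` with `βʰ = β ∘ dp`, and only the second term of
`Π` survives. This is the source of the minus sign relating the two differentials. -/
theorem dProj_sharp (hsymm : ∀ x, (h x).IsSymm) (z : TangentBundle 𝓘(ℝ, E) M)
    (φ : Cotangent 𝓘(ℝ, E).tangent z) :
    dProj z (sharp (tangentBivector h z) φ) = - sharp (h z.1) (φ.comp (verticalLift z)) := by
  have key : ∀ β : Cotangent 𝓘(ℝ, E) z.1, β (dProj z (sharp (tangentBivector h z) φ)) =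
      β (- sharp (h z.1) (φ.comp (verticalLift z))) := by
    intro β
    have h1 := apply_sharp (tangentBivector h z) φ (β.comp (dProj z))
    have h2 : (β.comp (dProj z)).comp (verticalLift z) = 0 := by
      ext v
      change β (dProj z (verticalLift z v)) = 0
      rw [dProj_verticalLift, map_zero]
    have h3 : (β.comp (dProj z)).comp (horizontalLift z) = β := by
      ext v
      change β (dProj z (horizontalLift z v)) = β v
      rw [dProj_horizontalLift]
    rw [tangentBivector_apply, h2, h3, map_zero, zero_sub] at h1
    rw [map_neg, apply_sharp, ← (hsymm z.1).eq]
    exact h1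
  by_contra hne
  obtain ⟨f, hf⟩ := SeparatingDual.exists_separating_of_ne (R := ℝ) (V := E) hne
  exact hf (key f)

theorem sharp_comp_connectionMap (hsymm : ∀ x, (h x).IsSymm) (z : TangentBundle 𝓘(ℝ, E) M)
    (ξ : Cotangent 𝓘(ℝ, E) z.1) :
    sharp (tangentBivector h z) (ξ.comp (connectionMap z)) =
      - horizontalLift z (sharp (h z.1) ξ) := by
  have key : ∀ φ : Cotangent 𝓘(ℝ, E).tangent z,
      φ (sharp (tangentBivector h z) (ξ.comp (connectionMap z))) =
        φ (- horizontalLift z (sharp (h z.1) ξ)) := by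
    intro φ
    have h1 := apply_sharp (h z.1) ξ (φ.comp (horizontalLift z))
    rw [apply_sharp, tangentBivector_apply, comp_connectionMap_comp_horizontalLift,
      comp_connectionMap_comp_verticalLift, map_zero, map_neg, ← (hsymm z.1).eq ξ]
    rw [LinearMap.zero_apply, zero_sub, ← h1]
    rfl
  by_contra hne
  obtain ⟨f, hf⟩ := SeparatingDual.exists_separating_of_ne (R := ℝ) (V := E × E) hne
  exact hf (key f)

end Affine

/-! ### Lifting to `TM` and restricting to the zero section. -/

section Affine

variable {E : Type*} [NormedAddCommGroup E] [NormedSpace ℝ E]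
  {M : Type*} [TopologicalSpace M] [ChartedSpace E M] [HasGroupoid M (affineGroupoid E)]
  {h : ∀ x : M, LinearMap.BilinForm ℝ (Cotangent 𝓘(ℝ, E) x)}

theorem verticalLiftMultivector_apply {k : ℕ} (Q : RawMultivectorField 𝓘(ℝ, E) M k)
    (z : TangentBundle 𝓘(ℝ, E) M) (φ : Fin k → Cotangent 𝓘(ℝ, E).tangent z) :
    verticalLiftMultivector Q z φ = Q z.1 fun i => (φ i).comp (verticalLift z) := rfl

theorem mvfderiv_comp_proj {g : M → ℝ} (z : TangentBundle 𝓘(ℝ, E) M)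
    (hg : MDifferentiableAt 𝓘(ℝ, E) 𝓘(ℝ, ℝ) g z.1) (w : TangentSpace 𝓘(ℝ, E).tangent z) :
    mvfderiv 𝓘(ℝ, E).tangent (g ∘ fun z' : TangentBundle 𝓘(ℝ, E) M => z'.1) z w =
      mvfderiv 𝓘(ℝ, E) g z.1 (dProj z w) :=
  mvfderiv_comp_apply z hg (mdifferentiableAt_tangent_proj z) w

theorem contMDiffOn_tangent_proj (z : TangentBundle 𝓘(ℝ, E) M) :
    ContMDiffOn 𝓘(ℝ, E).tangent 𝓘(ℝ, E) ∞ (fun w : TangentBundle 𝓘(ℝ, E) M => w.1)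
      (chartAt (ModelProd E E) z).source :=
  (contMDiff_proj (TangentSpace 𝓘(ℝ, E))).contMDiffOn

theorem mapsTo_proj_chart_source (z : TangentBundle 𝓘(ℝ, E) M) :
    MapsTo (fun w : TangentBundle 𝓘(ℝ, E) M => w.1) (chartAt (ModelProd E E) z).source
      (chartAt E z.1).source :=
  fun w hw => (TangentBundle.mem_chart_source_iff w z).1 hw

/-- The vertical lift of a smooth multivector field is smooth. -/
theorem verticalLiftMultivector_mem {k : ℕ} (Q : multivectorField 𝓘(ℝ, E) M k) :
    verticalLiftMultivector Q.1 ∈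
      multivectorField 𝓘(ℝ, E).tangent (TangentBundle 𝓘(ℝ, E) M) k := by
  intro z ξ
  refine ((Q.2 z.1 fun i => (ξ i).comp (ContinuousLinearMap.inr ℝ E E)).comp
    (contMDiffOn_tangent_proj z) (mapsTo_proj_chart_source z)).congr fun z' hz' => ?_
  rw [verticalLiftMultivector_apply]
  simp only [chartCovector_comp_verticalLift (mapsTo_proj_chart_source z hz')]
  rfl

theorem mdifferentiableAt_tangentBivector
    (hsmooth : ∀ (x₀ : M) (ξ η : E →L[ℝ] ℝ), ContMDiffOn 𝓘(ℝ, E) 𝓘(ℝ, ℝ) ∞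
      (fun y => h y (chartCovector 𝓘(ℝ, E) x₀ ξ y) (chartCovector 𝓘(ℝ, E) x₀ η y))
      (chartAt E x₀).source)
    (z : TangentBundle 𝓘(ℝ, E) M) (ξ η : E × E →L[ℝ] ℝ) :
    MDifferentiableAt 𝓘(ℝ, E).tangent 𝓘(ℝ, ℝ) (fun z' => tangentBivector h z'
      (chartCovector 𝓘(ℝ, E).tangent z ξ z') (chartCovector 𝓘(ℝ, E).tangent z η z')) z := by
  have h1 : ∀ ξ η : E →L[ℝ] ℝ, MDifferentiableAt 𝓘(ℝ, E).tangent 𝓘(ℝ, ℝ)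
      ((fun y => h y (chartCovector 𝓘(ℝ, E) z.1 ξ y) (chartCovector 𝓘(ℝ, E) z.1 η y)) ∘
        fun z' : TangentBundle 𝓘(ℝ, E) M => z'.1) z := fun ξ η =>
    (((hsmooth z.1 ξ η).contMDiffAt ((chartAt E z.1).open_source.mem_nhds
      (mem_chart_source E z.1))).mdifferentiableAt (by simp)).comp z
      (mdifferentiableAt_tangent_proj z)
  refine ((h1 (ξ.comp (ContinuousLinearMap.inl ℝ E E))
    (η.comp (ContinuousLinearMap.inr ℝ E E))).sub
    (h1 (η.comp (ContinuousLinearMap.inl ℝ E E))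
      (ξ.comp (ContinuousLinearMap.inr ℝ E E)))).congr_of_eventuallyEq ?_
  filter_upwards [eventually_proj_mem_chart_source z] with z' hz'
  rw [tangentBivector_apply, chartCovector_comp_verticalLift hz',
    chartCovector_comp_verticalLift hz', chartCovector_comp_horizontalLift hz',
    chartCovector_comp_horizontalLift hz']
  rfl

/-- The restriction of a multivector field on `TM` to the zero section, projected to its vertical
part. -/
def restrictVertical {k : ℕ}
    (P : RawMultivectorField 𝓘(ℝ, E).tangent (TangentBundle 𝓘(ℝ, E) M) k) :
    RawMultivectorField 𝓘(ℝ, E) M k :=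
  fun x => (P ⟨x, 0⟩).compLinearMap
    (ContinuousLinearMap.precomp ℝ (connectionMap (⟨x, 0⟩ : TangentBundle 𝓘(ℝ, E) M))).toLinearMap

theorem restrictVertical_apply {k : ℕ}
    (P : RawMultivectorField 𝓘(ℝ, E).tangent (TangentBundle 𝓘(ℝ, E) M) k) (x : M)
    (ξ : Fin k → Cotangent 𝓘(ℝ, E) x) :
    restrictVertical P x ξ =
      P ⟨x, 0⟩ fun i => (ξ i).comp (connectionMap (⟨x, 0⟩ : TangentBundle 𝓘(ℝ, E) M)) := rfl

theorem restrictVertical_mem {k : ℕ}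
    (P : multivectorField 𝓘(ℝ, E).tangent (TangentBundle 𝓘(ℝ, E) M) k) :
    restrictVertical P.1 ∈ multivectorField 𝓘(ℝ, E) M k := by
  intro x ξ
  let z : TangentBundle 𝓘(ℝ, E) M := ⟨x, 0⟩
  have h0 : ContMDiff 𝓘(ℝ, E) 𝓘(ℝ, E).tangent ∞
      (zeroSection E (TangentSpace 𝓘(ℝ, E) : M → Type _)) :=
    contMDiff_zeroSection ℝ (TangentSpace 𝓘(ℝ, E))
  refine ((P.2 z fun i => (ξ i).comp (ContinuousLinearMap.snd ℝ E E)).comp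
    (h0.contMDiffOn (s := (chartAt E x).source))
    fun y hy => mem_tangent_chart_source (z := z) (z' := ⟨y, 0⟩) hy).congr fun y hy => ?_
  rw [restrictVertical_apply]
  have h1 := fun i => chartCovector_comp_connectionMap (z := z) (z' := ⟨y, 0⟩) hy (ξ i)
  exact congrArg (P.1 ⟨y, 0⟩) (funext fun i => (h1 i).symm)

/-- The zero section is parallel, so horizontal vectors along it are tangent to it. -/
theorem horizontalLift_zero (x : M) (v : TangentSpace 𝓘(ℝ, E) x) :
    mfderiv 𝓘(ℝ, E) 𝓘(ℝ, E).tangent (fun y => (⟨y, 0⟩ : TangentBundle 𝓘(ℝ, E) M)) x v =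
      horizontalLift (⟨x, 0⟩ : TangentBundle 𝓘(ℝ, E) M) v := by
  have h1 : (fun y => (⟨y, 0⟩ : TangentBundle 𝓘(ℝ, E) M)) =
      parallelSection (⟨x, 0⟩ : TangentBundle 𝓘(ℝ, E) M) := by
    funext y
    simp [parallelSection]
  -- The tangent space in which the derivative lies depends on the map, so both sides are read in `E
  -- × E` before the maps are identified.
  have key : ∀ f : M → TangentBundle 𝓘(ℝ, E) M,
      f = parallelSection (⟨x, 0⟩ : TangentBundle 𝓘(ℝ, E) M) →
      (show E × E from mfderiv 𝓘(ℝ, E) 𝓘(ℝ, E).tangent f x v) =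
      (show E × E from horizontalLift (⟨x, 0⟩ : TangentBundle 𝓘(ℝ, E) M) v) := by
    rintro f rfl
    rfl
  exact key _ h1

variable [FiniteDimensional ℝ E]

/-- The components of `Tᵛ` are pulled back from `M`, so only the projection of the anchor matters,
and `dProj_sharp` gives the sign. -/
theorem localDifferential_verticalLiftMultivector (hsymm : ∀ x, (h x).IsSymm) {k : ℕ}
    (T : multivectorField 𝓘(ℝ, E) M k) (z : TangentBundle 𝓘(ℝ, E) M)
    (φ : Fin (k + 1) → Cotangent 𝓘(ℝ, E).tangent z) :
    localDifferential (fun z => sharp (tangentBivector h z)) (verticalLiftMultivector T.1) z φ =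
      - localDifferential (fun x => sharp (h x)) T.1 z.1 (fun j => (φ j).comp (verticalLift z)) := by
  rw [localDifferential, localDifferential, ← Finset.sum_neg_distrib]
  refine Finset.sum_congr rfl fun j _ => ?_
  have h1 : (fun z' => verticalLiftMultivector T.1 z' fun l =>
        coordExtend 𝓘(ℝ, E).tangent z (φ (j.succAbove l)) z') =ᶠ[𝓝 z]
      (fun y => T.1 y fun l =>
        coordExtend 𝓘(ℝ, E) z.1 ((φ (j.succAbove l)).comp (verticalLift z)) y) ∘
        fun z' : TangentBundle 𝓘(ℝ, E) M => z'.1 := by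
    filter_upwards [eventually_proj_mem_chart_source z] with z' hz'
    rw [verticalLiftMultivector_apply]
    simp only [coordExtend_comp_verticalLift hz']
    rfl
  have hd : MDifferentiableAt 𝓘(ℝ, E) 𝓘(ℝ, ℝ) (fun y => T.1 y fun l =>
      coordExtend 𝓘(ℝ, E) z.1 ((φ (j.succAbove l)).comp (verticalLift z)) y) z.1 :=
    mdifferentiableAt_component T z.1 _
  rw [mvfderiv_congr h1, mvfderiv_comp_proj z hd, dProj_sharp hsymm, map_neg]
  ring

/-- The anchor of `ξᵛ` is horizontal, hence tangent to the zero section, and differentiating along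
it sees only the values of `P` there. -/
theorem localDifferential_restrictVertical (hsymm : ∀ x, (h x).IsSymm) {k : ℕ}
    (P : multivectorField 𝓘(ℝ, E).tangent (TangentBundle 𝓘(ℝ, E) M) k) (x : M)
    (ξ : Fin (k + 1) → Cotangent 𝓘(ℝ, E) x) :
    localDifferential (fun z => sharp (tangentBivector h z)) P.1 ⟨x, 0⟩
        (fun j => (ξ j).comp (connectionMap (⟨x, 0⟩ : TangentBundle 𝓘(ℝ, E) M))) =
      - localDifferential (fun x => sharp (h x)) (restrictVertical P.1) x ξ := by
  rw [localDifferential, localDifferential, ← Finset.sum_neg_distrib]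
  refine Finset.sum_congr rfl fun j _ => ?_
  let z : TangentBundle 𝓘(ℝ, E) M := ⟨x, 0⟩
  have h1 : (fun y => restrictVertical P.1 y fun l =>
        coordExtend 𝓘(ℝ, E) x (ξ (j.succAbove l)) y) =ᶠ[𝓝 x]
      (fun z' => P.1 z' fun l =>
        coordExtend 𝓘(ℝ, E).tangent z ((ξ (j.succAbove l)).comp (connectionMap z)) z') ∘
        fun y => (⟨y, 0⟩ : TangentBundle 𝓘(ℝ, E) M) := by
    filter_upwards [(chartAt E x).open_source.mem_nhds (mem_chart_source E x)] with y hy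
    rw [restrictVertical_apply]
    have h2 := fun l => coordExtend_comp_connectionMap (z := z) (z' := ⟨y, 0⟩) hy (ξ l)
    exact congrArg (P.1 ⟨y, 0⟩) (funext fun l => (h2 (j.succAbove l)).symm)
  have h0 : ContMDiff 𝓘(ℝ, E) 𝓘(ℝ, E).tangent ∞ (fun y => (⟨y, 0⟩ : TangentBundle 𝓘(ℝ, E) M)) :=
    contMDiff_zeroSection ℝ (TangentSpace 𝓘(ℝ, E))
  have hd : MDifferentiableAt 𝓘(ℝ, E).tangent 𝓘(ℝ, ℝ) (fun z' => P.1 z' fun l =>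
      coordExtend 𝓘(ℝ, E).tangent z ((ξ (j.succAbove l)).comp (connectionMap z)) z') z :=
    mdifferentiableAt_component P z _
  have h3 := mvfderiv_comp_apply x (f := fun y => (⟨y, 0⟩ : TangentBundle 𝓘(ℝ, E) M)) hd
    (h0.mdifferentiable (by simp) x) (sharp (h x) (ξ j))
  rw [horizontalLift_zero] at h3
  rw [mvfderiv_congr h1, h3, sharp_comp_connectionMap hsymm z (ξ j), map_neg]
  ring

theorem bracketTorsion_tangentBivector (hh : IsPseudoHessian h)
    (φ ψ : OneForm 𝓘(ℝ, E).tangent (TangentBundle 𝓘(ℝ, E) M)) (z : TangentBundle 𝓘(ℝ, E) M)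
    (w : TangentSpace 𝓘(ℝ, E).tangent z) :
    bracketTorsion (fun z => sharp (tangentBivector h z))
        (koszulBracket 𝓘(ℝ, E).tangent (tangentBivector h)) φ ψ z w =
      mvfderiv 𝓘(ℝ, E).tangent (fun z' => tangentBivector h z'
        (coordExtend 𝓘(ℝ, E).tangent z (φ z) z') (coordExtend 𝓘(ℝ, E).tangent z (ψ z) z')) z w :=
  bracketTorsion_koszulBracket (tangentBivector h) tangentBivector_skew
    (mdifferentiableAt_tangentBivector hh.smooth z) φ ψ w

/-- The components of `Π` are constant along the fibres of `TM`. -/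
theorem bracketTorsion_comp_verticalLift (hh : IsPseudoHessian h)
    (φ ψ : OneForm 𝓘(ℝ, E).tangent (TangentBundle 𝓘(ℝ, E) M)) (z : TangentBundle 𝓘(ℝ, E) M) :
    (bracketTorsion (fun z => sharp (tangentBivector h z))
        (koszulBracket 𝓘(ℝ, E).tangent (tangentBivector h)) φ ψ z).comp (verticalLift z) = 0 := by
  ext v
  rw [ContinuousLinearMap.comp_apply, bracketTorsion_tangentBivector hh]
  have hd : ∀ ξ η : Cotangent 𝓘(ℝ, E) z.1, MDifferentiableAt 𝓘(ℝ, E) 𝓘(ℝ, ℝ) (fun y =>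
      h y (coordExtend 𝓘(ℝ, E) z.1 ξ y) (coordExtend 𝓘(ℝ, E) z.1 η y)) z.1 := fun ξ η =>
    ((hh.smooth z.1 _ _).contMDiffAt ((chartAt E z.1).open_source.mem_nhds
      (mem_chart_source E z.1))).mdifferentiableAt (by simp)
  let φ' : Cotangent 𝓘(ℝ, E).tangent z := φ z
  let ψ' : Cotangent 𝓘(ℝ, E).tangent z := ψ z
  have h1 : (fun z' => tangentBivector h z' (coordExtend 𝓘(ℝ, E).tangent z (φ z) z')
        (coordExtend 𝓘(ℝ, E).tangent z (ψ z) z')) =ᶠ[𝓝 z]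
      (fun y => h y (coordExtend 𝓘(ℝ, E) z.1 (φ'.comp (horizontalLift z)) y)
          (coordExtend 𝓘(ℝ, E) z.1 (ψ'.comp (verticalLift z)) y) -
        h y (coordExtend 𝓘(ℝ, E) z.1 (ψ'.comp (horizontalLift z)) y)
          (coordExtend 𝓘(ℝ, E) z.1 (φ'.comp (verticalLift z)) y)) ∘
        fun z' : TangentBundle 𝓘(ℝ, E) M => z'.1 := by
    filter_upwards [eventually_proj_mem_chart_source z] with z' hz'
    rw [tangentBivector_apply, coordExtend_comp_verticalLift hz',
      coordExtend_comp_verticalLift hz', coordExtend_comp_horizontalLift hz',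
      coordExtend_comp_horizontalLift hz']
    rfl
  have hd' := (hd (φ'.comp (horizontalLift z)) (ψ'.comp (verticalLift z))).sub
    (hd (ψ'.comp (horizontalLift z)) (φ'.comp (verticalLift z)))
  rw [mvfderiv_congr h1]
  refine (mvfderiv_comp_proj z hd' _).trans ?_
  rw [dProj_verticalLift, map_zero]
  rfl

/-- The constant extensions of `ξᵛ` and `ηᵛ` have no horizontal part, so `Π` vanishes on them in a
whole neighbourhood. -/
theorem bracketTorsion_eq_zero (hh : IsPseudoHessian h)
    (φ ψ : OneForm 𝓘(ℝ, E).tangent (TangentBundle 𝓘(ℝ, E) M)) (z : TangentBundle 𝓘(ℝ, E) M)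
    {ξ η : Cotangent 𝓘(ℝ, E) z.1} (hφ : φ z = ξ.comp (connectionMap z))
    (hψ : ψ z = η.comp (connectionMap z)) :
    bracketTorsion (fun z => sharp (tangentBivector h z))
        (koszulBracket 𝓘(ℝ, E).tangent (tangentBivector h)) φ ψ z = 0 := by
  ext w
  rw [bracketTorsion_tangentBivector hh]
  have h1 : (fun z' => tangentBivector h z' (coordExtend 𝓘(ℝ, E).tangent z (φ z) z')
        (coordExtend 𝓘(ℝ, E).tangent z (ψ z) z')) =ᶠ[𝓝 z] fun _ => 0 := by
    filter_upwards [eventually_proj_mem_chart_source z] with z' hz'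
    rw [hφ, hψ, tangentBivector_apply, coordExtend_comp_connectionMap hz',
      coordExtend_comp_connectionMap hz', comp_connectionMap_comp_horizontalLift,
      comp_connectionMap_comp_horizontalLift]
    simp
  rw [mvfderiv_congr h1, mvfderiv_const]

theorem bracketTorsion_hessianBracket (α β : OneForm 𝓘(ℝ, E) M) (x : M) :
    bracketTorsion (fun x => sharp (h x)) (hessianBracket h) α β x = 0 :=
  sub_self _

end Affine

/-! ### Comparison of cocycles and coboundaries, and the map on cohomology. -/

section Affine

variable {E : Type*} [NormedAddCommGroup E] [NormedSpace ℝ E] [FiniteDimensional ℝ E]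
  {M : Type*} [TopologicalSpace M] [ChartedSpace E M] [HasGroupoid M (affineGroupoid E)]
  {h : ∀ x : M, LinearMap.BilinForm ℝ (Cotangent 𝓘(ℝ, E) x)}

theorem algebroidDifferential_hessian_apply {k : ℕ} (T : multivectorField 𝓘(ℝ, E) M k)
    (α : Fin (k + 1) → OneForm 𝓘(ℝ, E) M) (x : M) :
    algebroidDifferential 𝓘(ℝ, E) (fun x => sharp (h x)) (hessianBracket h) k T α x =
      localDifferential (fun x => sharp (h x)) T.1 x (fun j => α j x) := by
  rw [algebroidDifferential_apply, add_eq_left]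
  refine Finset.sum_eq_zero fun j _ => Finset.sum_eq_zero fun i _ => ?_
  rw [bracketTorsion_hessianBracket, (T.1 x).map_coord_zero i (Function.update_self ..), mul_zero]

omit [FiniteDimensional ℝ E] in
theorem localDifferential_neg (ρ : ∀ x : M, Cotangent 𝓘(ℝ, E) x →ₗ[ℝ] TangentSpace 𝓘(ℝ, E) x)
    {k : ℕ} (Q : RawMultivectorField 𝓘(ℝ, E) M k) (x : M)
    (ξ : Fin (k + 1) → Cotangent 𝓘(ℝ, E) x) :
    localDifferential ρ (-Q) x ξ = - localDifferential ρ Q x ξ := by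
  rw [localDifferential, localDifferential, ← Finset.sum_neg_distrib]
  refine Finset.sum_congr rfl fun j _ => ?_
  have h1 : mvfderiv 𝓘(ℝ, E) (fun y => (-Q) y fun l =>
      coordExtend 𝓘(ℝ, E) x (ξ (j.succAbove l)) y) x = - mvfderiv 𝓘(ℝ, E) (fun y => Q y fun l =>
      coordExtend 𝓘(ℝ, E) x (ξ (j.succAbove l)) y) x := mvfderiv_neg
  rw [h1, neg_apply, mul_neg]

/-- The vertical lift as a linear map on smooth multivector fields. -/
def verticalLiftLinearMap (k : ℕ) : multivectorField 𝓘(ℝ, E) M k →ₗ[ℝ]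
    multivectorField 𝓘(ℝ, E).tangent (TangentBundle 𝓘(ℝ, E) M) k where
  toFun Q := ⟨verticalLiftMultivector Q.1, verticalLiftMultivector_mem Q⟩
  map_add' _ _ := rfl
  map_smul' _ _ := rfl

/-- `Tᵛ` sees only vertical parts and the torsion has none, so only the local differential remains.
-/
theorem algebroidDifferential_verticalLift_apply (hh : IsPseudoHessian h) {k : ℕ}
    (T : multivectorField 𝓘(ℝ, E) M k)
    (φ : Fin (k + 1) → OneForm 𝓘(ℝ, E).tangent (TangentBundle 𝓘(ℝ, E) M))
    (z : TangentBundle 𝓘(ℝ, E) M) :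
    algebroidDifferential 𝓘(ℝ, E).tangent (fun z => sharp (tangentBivector h z))
        (koszulBracket 𝓘(ℝ, E).tangent (tangentBivector h)) k (verticalLiftLinearMap k T) φ z =
      - localDifferential (fun x => sharp (h x)) T.1 z.1
        (fun j => (show Cotangent 𝓘(ℝ, E).tangent z from φ j z).comp (verticalLift z)) := by
  rw [algebroidDifferential_apply]
  refine Eq.trans ?_ (localDifferential_verticalLiftMultivector hh.symm T z fun j => φ j z)
  refine add_eq_left.2 (Finset.sum_eq_zero fun j _ => Finset.sum_eq_zero fun i _ => ?_)
  refine mul_eq_zero_of_right _ ((T.1 z.1).map_coord_zero i ?_)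
  rw [← bracketTorsion_comp_verticalLift hh (φ i.castSucc) (φ j) z]
  exact congrArg (fun ψ : Cotangent 𝓘(ℝ, E).tangent z => ψ.comp (verticalLift z))
    (Function.update_self ..)

theorem algebroidDifferential_comp_connectionMap (hh : IsPseudoHessian h) {k : ℕ}
    (P : multivectorField 𝓘(ℝ, E).tangent (TangentBundle 𝓘(ℝ, E) M) k) (x : M)
    (ξ : Fin (k + 1) → Cotangent 𝓘(ℝ, E) x)
    (φ : Fin (k + 1) → OneForm 𝓘(ℝ, E).tangent (TangentBundle 𝓘(ℝ, E) M))
    (hφ : ∀ j, φ j (⟨x, 0⟩ : TangentBundle 𝓘(ℝ, E) M) =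
      (ξ j).comp (connectionMap (⟨x, 0⟩ : TangentBundle 𝓘(ℝ, E) M))) :
    algebroidDifferential 𝓘(ℝ, E).tangent (fun z => sharp (tangentBivector h z))
        (koszulBracket 𝓘(ℝ, E).tangent (tangentBivector h)) k P φ ⟨x, 0⟩ =
      - localDifferential (fun x => sharp (h x)) (restrictVertical P.1) x ξ := by
  rw [algebroidDifferential_apply, ← localDifferential_restrictVertical hh.symm P x ξ]
  simp only [hφ]
  refine add_eq_left.2 (Finset.sum_eq_zero fun j _ => Finset.sum_eq_zero fun i _ => ?_)
  refine mul_eq_zero_of_right _ ((P.1 _).map_coord_zero i ?_)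
  rw [Function.update_self]
  exact bracketTorsion_eq_zero hh _ _ ⟨x, 0⟩ (hφ _) (hφ _)

variable [T2Space M]

/-- The differential is evaluated on global forms; prescribing their values at a point turns its
equations into pointwise ones on covectors. -/
theorem exists_oneForm_apply_eq (x : M) (ξ : Cotangent 𝓘(ℝ, E) x) :
    ∃ α : OneForm 𝓘(ℝ, E) M, α x = ξ := by
  obtain ⟨f⟩ : Nonempty (SmoothBumpFunction 𝓘(ℝ, E) x) := inferInstance
  exact exists_oneForm_eq f.contMDiff f.tsupport_subset_chartAt_source f.eq_one ξ

theorem exists_oneForm_tangent_apply_eq (z : TangentBundle 𝓘(ℝ, E) M)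
    (φ : Cotangent 𝓘(ℝ, E).tangent z) :
    ∃ α : OneForm 𝓘(ℝ, E).tangent (TangentBundle 𝓘(ℝ, E) M), α z = φ := by
  obtain ⟨f⟩ : Nonempty (SmoothBumpFunction 𝓘(ℝ, E) z.1) := inferInstance
  have hp : ContMDiff 𝓘(ℝ, E).tangent 𝓘(ℝ, E) ∞ (fun w : TangentBundle 𝓘(ℝ, E) M => w.1) :=
    contMDiff_proj (TangentSpace 𝓘(ℝ, E))
  -- A bump function on `M` pulled back to `TM` suffices, since the chart domains of `TM` are full
  -- preimages of those of `M`.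
  refine exists_oneForm_eq (f := f ∘ fun w : TangentBundle 𝓘(ℝ, E) M => w.1)
    (f.contMDiff.comp hp) (fun w hw => ?_) f.eq_one φ
  exact mem_tangent_chart_source
    (f.tsupport_subset_chartAt_source (tsupport_comp_subset_preimage f hp.continuous hw))

theorem mem_hessianCocycles_iff {k : ℕ} (Q : multivectorField 𝓘(ℝ, E) M k) :
    Q ∈ hessianCocycles h k ↔ ∀ x ξ, localDifferential (fun x => sharp (h x)) Q.1 x ξ = 0 := by
  refine ⟨fun hQ x ξ => ?_, fun hQ => ?_⟩
  · choose α hα using fun j => exists_oneForm_apply_eq x (ξ j)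
    have h1 := congrFun (congrFun (LinearMap.mem_ker.1 hQ) α) x
    rw [algebroidDifferential_hessian_apply] at h1
    simpa only [hα] using! h1
  · refine LinearMap.mem_ker.2 (funext fun α => funext fun x => ?_)
    rw [algebroidDifferential_hessian_apply, hQ]
    rfl

theorem mem_hessian_coboundaries_iff {k : ℕ} (Q : multivectorField 𝓘(ℝ, E) M (k + 1)) :
    Q ∈ coboundaries 𝓘(ℝ, E) (fun x => sharp (h x)) (hessianBracket h) (k + 1) ↔
      ∃ T : multivectorField 𝓘(ℝ, E) M k, ∀ x ξ,
        localDifferential (fun x => sharp (h x)) T.1 x ξ = Q.1 x ξ := by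
  refine exists_congr fun T => ⟨fun hT x ξ => ?_, fun hT => ?_⟩
  · choose α hα using fun j => exists_oneForm_apply_eq x (ξ j)
    have h1 := congrFun (congrFun hT α) x
    rw [algebroidDifferential_hessian_apply] at h1
    simp only [hα] at h1
    refine h1.trans ?_
    change Q.1 x (fun j => α j x) = Q.1 x ξ
    simp only [hα]
  · refine funext fun α => funext fun x => ?_
    rw [algebroidDifferential_hessian_apply, hT]
    rfl

theorem verticalLift_mem_poissonCocycles (hh : IsPseudoHessian h) {k : ℕ}
    {Q : multivectorField 𝓘(ℝ, E) M k} (hQ : Q ∈ hessianCocycles h k) :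
    verticalLiftLinearMap k Q ∈ poissonCocycles 𝓘(ℝ, E).tangent (tangentBivector h) k := by
  refine LinearMap.mem_ker.2 (funext fun φ => funext fun z => ?_)
  rw [algebroidDifferential_verticalLift_apply hh, (mem_hessianCocycles_iff Q).1 hQ, neg_zero]
  rfl

/-- The implication from right to left makes `V` well defined on classes; the other one is its
injectivity. -/
theorem verticalLift_mem_coboundaries_iff (hh : IsPseudoHessian h) {k : ℕ}
    (Q : multivectorField 𝓘(ℝ, E) M k) :
    verticalLiftLinearMap k Q ∈ coboundaries 𝓘(ℝ, E).tangent
        (fun z => sharp (tangentBivector h z))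
        (koszulBracket 𝓘(ℝ, E).tangent (tangentBivector h)) k ↔
      Q ∈ coboundaries 𝓘(ℝ, E) (fun x => sharp (h x)) (hessianBracket h) k := by
  have hrestrict : ∀ {k : ℕ} (Q : multivectorField 𝓘(ℝ, E) M k) (x : M)
      (ξ : Fin k → Cotangent 𝓘(ℝ, E) x), (verticalLiftLinearMap k Q).1 ⟨x, 0⟩
        (fun i => (ξ i).comp (connectionMap (⟨x, 0⟩ : TangentBundle 𝓘(ℝ, E) M))) = Q.1 x ξ := by
    intro k Q x ξ
    refine congrArg (Q.1 x) (funext fun i => ?_)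
    exact comp_connectionMap_comp_verticalLift (⟨x, 0⟩ : TangentBundle 𝓘(ℝ, E) M) (ξ i)
  cases k with
  | zero =>
    refine ⟨fun hQ => ?_, fun hQ => ?_⟩
    -- In degree `0` the coboundaries are zero, so the claim is that `Q` is recovered from its lift
    -- on the zero section.
    · have h0 : verticalLiftLinearMap 0 Q = 0 := (Submodule.mem_bot ℝ).1 hQ
      refine (Submodule.mem_bot ℝ).2 (Subtype.ext (funext fun x => AlternatingMap.ext fun ξ => ?_))
      rw [← hrestrict, h0]
      rfl
    · have h0 : Q = 0 := (Submodule.mem_bot ℝ).1 hQ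
      rw [h0, map_zero]
      exact zero_mem _
  | succ k =>
    rw [mem_hessian_coboundaries_iff]
    constructor
    · rintro ⟨P, hP⟩
      -- The minus sign offsets the one in `algebroidDifferential_comp_connectionMap`.
      refine ⟨- ⟨restrictVertical P.1, restrictVertical_mem P⟩, fun x ξ => ?_⟩
      choose φ hφ using fun j => exists_oneForm_tangent_apply_eq (⟨x, 0⟩ : TangentBundle 𝓘(ℝ, E) M)
        ((ξ j).comp (connectionMap (⟨x, 0⟩ : TangentBundle 𝓘(ℝ, E) M)))
      have h1 := congrFun (congrFun hP φ) ⟨x, 0⟩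
      rw [algebroidDifferential_comp_connectionMap hh P x ξ φ hφ] at h1
      rw [← hrestrict Q x ξ]
      refine (localDifferential_neg _ (restrictVertical P.1) x ξ).trans (h1.trans ?_)
      exact congrArg ((verticalLiftLinearMap (k + 1) Q).1 ⟨x, 0⟩) (funext hφ)
    · rintro ⟨T, hT⟩
      -- Since `d_Π Tᵛ = -(d_h T)ᵛ`, the primitive of `Qᵛ` is the lift of `-T`.
      refine ⟨verticalLiftLinearMap k (-T), funext fun φ => funext fun z => ?_⟩
      rw [map_neg, map_neg]
      change - algebroidDifferential _ _ _ _ _ _ _ = _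
      rw [algebroidDifferential_verticalLift_apply hh, hT, neg_neg]
      rfl

/-- The map induced by the vertical lift on cohomology in degree `k`. -/
def verticalLiftCohomology (hh : IsPseudoHessian h) (k : ℕ) :
    HessianCohomology h k →ₗ[ℝ] PoissonCohomology 𝓘(ℝ, E).tangent (tangentBivector h) k :=
  Submodule.mapQ _ _ ((verticalLiftLinearMap k).restrict fun _ hQ =>
      verticalLift_mem_poissonCocycles hh hQ)
    fun Q hQ => (verticalLift_mem_coboundaries_iff hh Q.1).2 hQ

theorem verticalLiftCohomology_injective (hh : IsPseudoHessian h) (k : ℕ) :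
    Function.Injective (verticalLiftCohomology hh k) := by
  rw [injective_iff_map_eq_zero]
  intro a ha
  obtain ⟨Q, rfl⟩ := Submodule.Quotient.mk_surjective _ a
  have hb := (Submodule.Quotient.mk_eq_zero ((coboundaries 𝓘(ℝ, E).tangent
    (fun z => sharp (tangentBivector h z))
    (koszulBracket 𝓘(ℝ, E).tangent (tangentBivector h)) k).submoduleOf _)).1 ha
  exact (Submodule.Quotient.mk_eq_zero _).2 ((verticalLift_mem_coboundaries_iff hh Q.1).1 hb)

end Affine

end AffinePoisson

end

theorem mainTheorem11 {E : Type*} [NormedAddCommGroup E] [NormedSpace ℝ E] [FiniteDimensional ℝ E]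
    {M : Type*} [TopologicalSpace M] [T2Space M] [ChartedSpace E M]
    [HasGroupoid M (affineGroupoid E)]
    (h : ∀ x : M, LinearMap.BilinForm ℝ (Cotangent 𝓘(ℝ, E) x)) (hh : IsPseudoHessian h) :
    ∃ V : (⨁ k, HessianCohomology h k) →ₗ[ℝ]
        (⨁ k, PoissonCohomology 𝓘(ℝ, E).tangent (tangentBivector h) k),
      (∀ (k : ℕ) (Q : hessianCocycles h k),
        ∃ P : poissonCocycles 𝓘(ℝ, E).tangent (tangentBivector h) k,
          (P : RawMultivectorField 𝓘(ℝ, E).tangent (TangentBundle 𝓘(ℝ, E) M) k) =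
            verticalLiftMultivector (Q : RawMultivectorField 𝓘(ℝ, E) M k) ∧
          V (DirectSum.lof ℝ ℕ (HessianCohomology h) k (Submodule.Quotient.mk Q)) =
            DirectSum.lof ℝ ℕ (PoissonCohomology 𝓘(ℝ, E).tangent (tangentBivector h)) k
              (Submodule.Quotient.mk P)) ∧
      Function.Injective V := by
  refine ⟨DirectSum.lmap fun k => verticalLiftCohomology hh k, fun k Q =>
    ⟨⟨verticalLiftLinearMap k Q.1, verticalLift_mem_poissonCocycles hh Q.2⟩, rfl, ?_⟩,
    (DirectSum.lmap_injective _).2 fun k => verticalLiftCohomology_injective hh k⟩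
  rw [DirectSum.lmap_lof]
  rfl
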